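/- **Notation and definitions.** Let $I=[0,1]$ and $\Delta=\{(s,t)\in I^2: s\le t\}$, and let $X$ be a complex Banach space. A map $t\mapsto F(t)$ from $I$ to the bounded operators on $X$ is *strongly continuously differentiable* if $t\mapsto F(t)x$ is continuously differentiable on $I$ (one-sidedly at the endpoints) for every $x\in X$; its strong derivative is $F'(t)x=\frac{d}{dt}F(t)x$. For densely defined linear operators $A(t):D(A(t))\subset X\to X$ ($t\in I$), an *evolution system for $A$ on the spaces $D(A(t))$* is a family of bounded operators $U(t,s)$, $(s,t)\in\Delta$, such that (a) for every $s\in[0,1)$ and $y\in D(A(s))$ the map $[s,1]\ni t\mapsto U(t,s)y$ is continuously differentiable with $U(s,s)y=y$, $U(t,s)y\in D(A(t))$ and $\frac{d}{dt}U(t,s)y=A(t)U(t,s)y$ for all $t\in[s,1]$; and (b) $U(t,s)U(s,r)=U(t,r)$ for $(r,s),(s,t)\in\Delta$, and $(s,t)\mapsto U(t,s)x$ is continuous on $\Delta$ for every $x\in X$. Such a system is unique if it exists; one writes $U(t)=U(t,0)$. For a densely defined closed operator $A$ with nonempty resolvent set $\rho(A)$ and a spectral value $\lambda$ of $A$, a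 bounded projection $P$ is *weakly associated with $A$ and $\lambda$* if $PA\subset AP$, $PD(A)=PX$, $A|_{PD(A)}-\lambda$ is nilpotent, and $A|_{(1-P)D(A)}-\lambda$ is injective with dense range in $(1-P)X$. Finally $[S,T]=ST-TS$. **Theorem.** Let $A(t):D(A(t))\subset X\to X$ be a densely defined closed linear operator for every $t\in I$. Suppose that for every $\varepsilon\in(0,\infty)$ there is an evolution system $U_\varepsilon$ for $\frac1\varepsilon A$ on the spaces $D(A(t))$, and that there is a constant $M\in[1,\infty)$ with $\|U_\varepsilon(t,s)\|\le M$ for all $(s,t)\in\Delta$ and $\varepsilon\in(0,\infty)$. Suppose that $\lambda(t)$ is an eigenvalue of $A(t)$ for every $t\in I$, and that there are $\delta_0\in(0,\infty)$ and $\vartheta(t)\in\mathbb R$ such that $\lambda(t)+\delta e^{i\vartheta(t)}\in\rho(A(t))$ for all $\delta\in(0,\delta_0]$ and $t\in I$, the maps $t\mapsto\lambda(t)$ and $t\mapsto e^{i\vartheta(t)}$ are continuously differentiable on $I$, and $t\mapsto\big(\lambda(t)+\delta e^{i\vartheta(t)}-A(t)\big)^{-1}$ is strongly continuously differentiable on $I$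 for every $\delta\in(0,\delta_0]$. Suppose that $P(t)$ is a bounded projection in $X$ for every $t\in I$ such that $P(t)$ is weakly associated with $A(t)$ and $\lambda(t)$ for almost every $t\in I$ and such that, for some integer $m_0\ge 1$, $$P(t)A(t)\subset A(t)P(t)\quad\text{and}\quad P(t)X\subset\ker(A(t)-\lambda(t))^{m_0}\qquad(t\in I).$$ Suppose that there are $M_0,M_0'\in(0,\infty)$ such that for all $\delta\in(0,\delta_0]$ and $t\in I$ $$\Big\|\big(\lambda(t)+\delta e^{i\vartheta(t)}-A(t)\big)^{-1}(1-P(t))\Big\|\le\frac{M_0}{\delta},\qquad \Big\|\frac{d}{dt}\Big(\big(\lambda(t)+\delta e^{i\vartheta(t)}-A(t)\big)^{-1}(1-P(t))\Big)\Big\|\le\frac{M_0'}{\delta^{m_0+1}},$$ where the derivative is the strong derivative. Finally let $\operatorname{rk}P(0)<\infty$ and let $t\mapsto P(t)$ be strongly continuously differentiable on $I$. Then the following hold. (i) For every $\varepsilon\in(0,\infty)$ the operators $\frac1\varepsilon A(t)P(t)+[P'(t),P(t)]$ are defined on all of $X$, the evolution system $V_{0\,\varepsilon}$ for $\frac1\varepsilon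 AP+[P',P]$ on $X$ exists, and $$\sup_{t\in I}\big\|\big(U_\varepsilon(t)-V_{0\,\varepsilon}(t)\big)P(0)\big\|\longrightarrow 0\qquad(\varepsilon\searrow 0).$$ (ii) If $X$ is reflexive and $t\mapsto P(t)$ is continuously differentiable on $I$ in the operator norm, then $$\sup_{t\in I}\big\|U_\varepsilon(t)-V_\varepsilon(t)\big\|\longrightarrow 0\qquad(\varepsilon\searrow 0),$$ whenever the evolution system $V_\varepsilon$ for $\frac1\varepsilon A+[P',P]$ on the spaces $D(A(t))$ exists for every $\varepsilon\in(0,\infty)$. -/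

import Mathlib

open scoped Topology

namespace Adiabatic

variable {X : Type*} [NormedAddCommGroup X] [NormedSpace ℂ X]

/-- The compact time interval `I = [0,1]`. -/
abbrev I : Set ℝ := Set.Icc 0 1

/-- The triangle `Δ` of all pairs `(s, t)` in `I × I` with `s ≤ t`. -/
def Triangle : Set (ℝ × ℝ) := {p | p.1 ∈ I ∧ p.2 ∈ I ∧ p.1 ≤ p.2}

/-! ### Strong continuous differentiability -/

/-- `t ↦ F t` is strongly continuously differentiable on `I` (one-sidedly at the endpoints). -/
def StrongC1 (F : ℝ → X →L[ℂ] X) : Prop :=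
  ∀ x : X, ContDiffOn ℝ 1 (fun t => F t x) I

open Classical in
/-- The strong derivative of `F` at the time `t` relative to `I`, as a bounded operator.
It has the value `0` if there is no bounded operator `T` with `d/dt (F t x) = T x` for all `x`;
for strongly continuously differentiable `F` such a `T` always exists, see
`StrongC1.hasDerivWithinAt`. -/
noncomputable def strongDeriv (F : ℝ → X →L[ℂ] X) (t : ℝ) : X →L[ℂ] X :=
  if h : ∃ T : X →L[ℂ] X, ∀ x, HasDerivWithinAt (fun s => F s x) (T x) I t then h.choose else 0

/-! ### Unbounded operators: resolvent, eigenvalues, powers, products -/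

/-- `R` is the bounded two-sided inverse of `z - A : D(A) → X`. -/
def IsResolventAt (A : X →ₗ.[ℂ] X) (z : ℂ) (R : X →L[ℂ] X) : Prop :=
  (∀ x : A.domain, R (z • (x : X) - A x) = x) ∧
    ∀ y : X, ∃ h : R y ∈ A.domain, z • R y - A ⟨R y, h⟩ = y

/-- The resolvent set `ρ(A)`. -/
def resolventSetOf (A : X →ₗ.[ℂ] X) : Set ℂ := {z | ∃ R : X →L[ℂ] X, IsResolventAt A z R}

open Classical in
/-- The resolvent `(z - A)⁻¹` for `z ∈ ρ(A)` (and `0` for other `z`). -/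
noncomputable def resolventOp (A : X →ₗ.[ℂ] X) (z : ℂ) : X →L[ℂ] X :=
  if h : ∃ R : X →L[ℂ] X, IsResolventAt A z R then h.choose else 0

/-- `l` is an eigenvalue of `A`. -/
def IsEigenvalue (A : X →ₗ.[ℂ] X) (l : ℂ) : Prop :=
  ∃ x : A.domain, (x : X) ≠ 0 ∧ A x = l • (x : X)

/-- `kerPow A l m` is `ker (A - l)^m`, with the natural (iterated) domain of `(A - l)^m`. -/
def kerPow (A : X →ₗ.[ℂ] X) (l : ℂ) : ℕ → Set X
  | 0 => {0}
  | m + 1 => {x | ∃ h : x ∈ A.domain, A ⟨x, h⟩ - l • x ∈ kerPow A l m}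

/-- The inclusion `P A ⊂ A P` of operators, that is, `P` commutes with `A`. -/
def CommutesWith (P : X →L[ℂ] X) (A : X →ₗ.[ℂ] X) : Prop :=
  ∀ x : A.domain, ∃ h : P x ∈ A.domain, A ⟨P x, h⟩ = P (A x)

/-- The product `A P`, with domain `{x | P x ∈ D(A)}`. -/
def opComp (A : X →ₗ.[ℂ] X) (P : X →L[ℂ] X) : X →ₗ.[ℂ] X where
  domain := A.domain.comap (P : X →ₗ[ℂ] X)
  toFun := A.toFun ∘ₗ ((P : X →ₗ[ℂ] X).restrict fun _ hx => hx)

/-- The commutator `[S, T] = S T - T S`. -/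
def comm (S T : X →L[ℂ] X) : X →L[ℂ] X := S ∘L T - T ∘L S

/-- The operator `(1/ε) A + B`, with domain `D(A)`, for bounded `B`. -/
noncomputable def scaledAdd (ε : ℝ) (A : X →ₗ.[ℂ] X) (B : X →L[ℂ] X) : X →ₗ.[ℂ] X :=
  (B : X →ₗ[ℂ] X) +ᵥ ((1 / (ε : ℂ)) • A)

/-! ### Weakly associated projections -/

/-- The bounded projection `P` is weakly associated with `A` and `l`. The notion is used for
densely defined closed `A` with nonempty resolvent set and spectral values `l` of `A`.
Because of `commutes`, the subspace `(1 - P) D(A)` consists of all `x ∈ D(A)` with `P x = 0`,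
and `A` leaves `P D(A)` and maps `(1 - P) D(A)` to `(1 - P) X`. -/
structure WeaklyAssociated (A : X →ₗ.[ℂ] X) (l : ℂ) (P : X →L[ℂ] X) : Prop where
  idem : P ∘L P = P
  commutes : CommutesWith P A
  image_domain : P '' (A.domain : Set X) = Set.range P
  /-- `A|_{P D(A)} - l` is nilpotent. -/
  nilpotent : ∃ m : ℕ, ∀ x : X, P x ∈ kerPow A l m
  /-- `A|_{(1-P) D(A)} - l` is injective. -/
  injective : ∀ x : A.domain, P x = 0 → A x = l • (x : X) → (x : X) = 0
  /-- `A|_{(1-P) D(A)} - l` has dense range in `(1 - P) X`. -/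
  dense_range : ∀ y : X, P y = 0 →
    y ∈ closure {z : X | ∃ x : A.domain, P x = 0 ∧ z = A x - l • (x : X)}

/-! ### Evolution systems -/

/-- `U t s` (`0 ≤ s ≤ t ≤ 1`) is a (solving) evolution system for the family `A` of operators on
the spaces `D(A t)`. -/
structure IsEvolutionSystem (A : ℝ → X →ₗ.[ℂ] X) (U : ℝ → ℝ → X →L[ℂ] X) : Prop where
  init : ∀ s ∈ Set.Ico (0 : ℝ) 1, ∀ y ∈ (A s).domain, U s s y = y
  contDiffOn : ∀ s ∈ Set.Ico (0 : ℝ) 1, ∀ y ∈ (A s).domain,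
    ContDiffOn ℝ 1 (fun t => U t s y) (Set.Icc s 1)
  solves : ∀ s ∈ Set.Ico (0 : ℝ) 1, ∀ y ∈ (A s).domain, ∀ t ∈ Set.Icc s 1,
    ∃ h : U t s y ∈ (A t).domain,
      HasDerivWithinAt (fun τ => U τ s y) (A t ⟨U t s y, h⟩) (Set.Icc s 1) t
  comp : ∀ r s t : ℝ, (r, s) ∈ Triangle → (s, t) ∈ Triangle → U t s ∘L U s r = U t r
  continuousOn : ∀ x : X, ContinuousOn (fun p : ℝ × ℝ => U p.2 p.1 x) Triangle

/-- `X` is reflexive: the canonical map of `X` into its bidual is onto. -/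
def Reflexive (X : Type*) [NormedAddCommGroup X] [NormedSpace ℂ X] : Prop :=
  Function.Surjective (NormedSpace.inclusionInDoubleDual ℂ X)

/-! ### Facts showing that the definitions by choice have the intended values -/

theorem isResolventAt_resolventOp {A : X →ₗ.[ℂ] X} {z : ℂ} (hz : z ∈ resolventSetOf A) :
    IsResolventAt A z (resolventOp A z) := by
  have h : ∃ R : X →L[ℂ] X, IsResolventAt A z R := hz
  rw [resolventOp, dif_pos h]
  exact h.choose_spec

theorem StrongC1.hasDerivWithinAt [CompleteSpace X] {F : ℝ → X →L[ℂ] X} (hF : StrongC1 F)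
    {t : ℝ} (ht : t ∈ I) (x : X) :
    HasDerivWithinAt (fun s => F s x) (strongDeriv F t x) I t := by
  have hd : ∀ x, HasDerivWithinAt (fun s => F s x) (derivWithin (fun s => F s x) I t) I t :=
    fun x => ((hF x).differentiableOn one_ne_zero t ht).hasDerivWithinAt
  have hT : ∃ T : X →L[ℂ] X, ∀ x, HasDerivWithinAt (fun s => F s x) (T x) I t := by
    have hne : (𝓝[I \ {t}] t).NeBot := by
      have hacc := (uniqueDiffOn_Icc (zero_lt_one' ℝ) t ht).accPt
      rw [accPt_iff_frequently_nhdsNE, Filter.frequently_iff_neBot] at hacc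
      refine hacc.mono ?_
      rw [Set.sdiff_eq, Set.inter_comm, nhdsWithin_inter', Set.compl_def]
      rfl
    obtain ⟨u, hu⟩ := Filter.exists_seq_tendsto (𝓝[I \ {t}] t)
    have hlim : ∀ x, Filter.Tendsto (fun n : ℕ => (((u n - t : ℝ) : ℂ)⁻¹ • (F (u n) - F t)) x)
        Filter.atTop (𝓝 (derivWithin (fun s => F s x) I t)) := fun x => by
      have := (hasDerivWithinAt_iff_tendsto_slope.1 (hd x)).comp hu
      refine this.congr fun n => ?_
      simp [slope, ← Complex.ofReal_inv, - Complex.ofReal_sub]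
    refine ⟨continuousLinearMapOfTendsto (fun n : ℕ => ((u n - t : ℝ) : ℂ)⁻¹ • (F (u n) - F t))
      (tendsto_pi_nhds.2 hlim), fun x => ?_⟩
    exact hd x
  rw [strongDeriv, dif_pos hT]
  exact hT.choose_spec x

end Adiabatic

/-!
The comparison of two evolutions rests on Duhamel's formula. Although `U t s` has only a one-sided
derivative with respect to `s` when the domains depend on time, this derivative is enough: a curve
`v` with `v' = (1/ε) A v + K v` satisfies `v t - U t 0 (v 0) = ∫ U t τ (K τ (v τ)) dτ`
(`IsEvolutionSystem.duhamel`). For `K = [P', P]` the trajectories respect the projections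
(`IsEvolutionSystem.intertwines`), so they may be studied separately in the ranges of `P`, where
`K = (1 - P) P' P`, and in the kernels, where `K = -P P' (1 - P)`.

If `K` were a commutator `A B - B A` on these subspaces, with `B` strongly continuously
differentiable, integration by parts would turn the integral into a term with a factor `ε`
(`IsTrajectory.integral_eq`). It suffices to solve this equation up to an error whose operator norm
has a small integral over `[0, 1]`, and then to let `ε` tend to zero with `B` fixed
(`exists_norm_sub_le`). No relation between the size of the error and `ε` is needed.

The approximate solutions are built from the reduced resolvents
`R δ = (λ + δ e^{iθ} - A)⁻¹ (1 - P)` and the nilpotent operator `S = (λ - A) P`. In the ranges of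
`P`, the operator `-R δ G` solves the equation with right-hand side `G` up to the terms
`δ e^{iθ} R δ G` and `R δ G S`. The first is small for small `δ`; the second contains one more
factor `S` and is treated in the same way, so that the procedure stops as `S` is nilpotent
(`SpectralData.exists_solvesCommutator_of_pow`). In the kernels of `P` the operators `G R δ` play
the same role. That `S` is strongly continuously differentiable follows from an expression of `S`
as a linear combination of resolvents (`exists_resolvent_combination`); `P'`, which is
only continuous, is replaced by difference quotients of `P`.

The error is small by dominated convergence. At almost every time, `δ R δ` tends to zero strongly
because `A - λ` has dense range in `(1 - P) X`, and composition with an operator of finite rank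
improves this to convergence in norm. For the kernels the adjoints of `δ R δ` have to tend to zero
strongly; in a reflexive space this follows from the injectivity of `A - λ` on `(1 - P) D(A)`.
-/

namespace Adiabatic

open Set Filter MeasureTheory

variable {X : Type*} [NormedAddCommGroup X] [NormedSpace ℂ X]

/-! ### Strongly continuous and strongly differentiable operator families -/

/-- `t ↦ F t x` is continuous on `I` for every `x`. -/
def StrongContOn (F : ℝ → X →L[ℂ] X) : Prop :=
  ∀ x : X, ContinuousOn (fun t => F t x) I

theorem exists_bound_of_isCompact [CompleteSpace X] {α : Type*} [TopologicalSpace α] {K : Set α}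
    (hK : IsCompact K) {F : α → X →L[ℂ] X} (hF : ∀ x, ContinuousOn (fun a => F a x) K) :
    ∃ C, 0 < C ∧ ∀ a ∈ K, ‖F a‖ ≤ C := by
  obtain ⟨C, hC⟩ := banach_steinhaus (g := fun a : K => F a) fun x => by
    obtain ⟨C, hC⟩ := hK.exists_bound_of_continuousOn (hF x)
    exact ⟨C, fun a => hC a a.2⟩
  exact ⟨max C 1, by positivity, fun a ha => (hC ⟨a, ha⟩).trans (le_max_left _ _)⟩

theorem tendsto_clm_apply {α : Type*} {f : Filter α} {F : α → X →L[ℂ] X} {v : α → X} {y z : X}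
    {C : ℝ} (hC : ∀ᶠ a in f, ‖F a‖ ≤ C) (hF : Tendsto (fun a => F a y) f (𝓝 z))
    (hv : Tendsto v f (𝓝 y)) : Tendsto (fun a => F a (v a)) f (𝓝 z) := by
  have h : Tendsto (fun a => F a (v a - y)) f (𝓝 0) := by
    have h0 : Tendsto (fun a => C * ‖v a - y‖) f (𝓝 0) := by
      have := (tendsto_iff_norm_sub_tendsto_zero.1 hv).const_mul C
      simpa using this
    refine squeeze_zero_norm' ?_ h0
    filter_upwards [hC] with a ha
    exact (F a).le_of_opNorm_le ha _
  simpa using h.add hF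

theorem continuousOn_clm_apply [CompleteSpace X] {α : Type*} [TopologicalSpace α] {K : Set α}
    (hK : IsCompact K) {F : α → X →L[ℂ] X} (hF : ∀ x, ContinuousOn (fun a => F a x) K)
    {v : α → X} (hv : ContinuousOn v K) : ContinuousOn (fun a => F a (v a)) K := by
  obtain ⟨C, -, hC⟩ := exists_bound_of_isCompact hK hF
  exact fun a ha => tendsto_clm_apply (eventually_mem_nhdsWithin.mono hC) (hF (v a) a ha) (hv a ha)

namespace StrongContOn

variable {F G : ℝ → X →L[ℂ] X}

theorem exists_bound [CompleteSpace X] (hF : StrongContOn F) :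
    ∃ C, 0 < C ∧ ∀ t ∈ I, ‖F t‖ ≤ C :=
  exists_bound_of_isCompact isCompact_Icc hF

theorem apply [CompleteSpace X] (hF : StrongContOn F) {v : ℝ → X} (hv : ContinuousOn v I) :
    ContinuousOn (fun t => F t (v t)) I :=
  continuousOn_clm_apply isCompact_Icc hF hv

theorem comp [CompleteSpace X] (hF : StrongContOn F) (hG : StrongContOn G) :
    StrongContOn (fun t => F t ∘L G t) :=
  fun x => hF.apply (hG x)

theorem add (hF : StrongContOn F) (hG : StrongContOn G) : StrongContOn (fun t => F t + G t) :=
  fun x => (hF x).add (hG x)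

theorem sub (hF : StrongContOn F) (hG : StrongContOn G) : StrongContOn (fun t => F t - G t) :=
  fun x => (hF x).sub (hG x)

theorem neg (hF : StrongContOn F) : StrongContOn (fun t => - F t) :=
  fun x => (hF x).neg

theorem smul {c : ℝ → ℂ} (hc : ContinuousOn c I) (hF : StrongContOn F) :
    StrongContOn (fun t => c t • F t) :=
  fun x => hc.smul (hF x)

theorem const (T : X →L[ℂ] X) : StrongContOn (fun _ => T) :=
  fun _ => continuousOn_const

theorem comm [CompleteSpace X] (hF : StrongContOn F) (hG : StrongContOn G) :
    StrongContOn (fun t => Adiabatic.comm (F t) (G t)) :=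
  (hF.comp hG).sub (hG.comp hF)

end StrongContOn

/-- Product rule for a strongly differentiable operator family applied to a differentiable
vector-valued function. -/
theorem hasDerivWithinAt_clm_apply [CompleteSpace X] {F : ℝ → X →L[ℂ] X} (hF : StrongContOn F)
    {F' : X →L[ℂ] X} {t : ℝ} (ht : t ∈ I)
    (hF' : ∀ x, HasDerivWithinAt (fun s => F s x) (F' x) I t) {v : ℝ → X} {v' : X}
    (hv : HasDerivWithinAt v v' I t) :
    HasDerivWithinAt (fun s => F s (v s)) (F' (v t) + F t v') I t := by
  rw [hasDerivWithinAt_iff_tendsto_slope] at hv ⊢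
  have h1 := hasDerivWithinAt_iff_tendsto_slope.1 (hF' (v t))
  obtain ⟨C, -, hC⟩ := hF.exists_bound
  have h2 : Tendsto (fun s => F s (slope v t s)) (𝓝[I \ {t}] t) (𝓝 (F t v')) :=
    tendsto_clm_apply (C := C)
      (by filter_upwards [self_mem_nhdsWithin] with s hs using hC s hs.1)
      ((hF v' t ht).mono_left (nhdsWithin_mono _ Set.sdiff_subset)) hv
  refine (h1.add h2).congr fun s => ?_
  simp only [slope, vsub_eq_sub, ContinuousLinearMap.map_smul_of_tower, map_sub, ← smul_add]
  congr 1
  abel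

namespace StrongC1

variable {F G : ℝ → X →L[ℂ] X}

theorem strongContOn (hF : StrongC1 F) : StrongContOn F := fun x => (hF x).continuousOn

theorem strongContOn_strongDeriv [CompleteSpace X] (hF : StrongC1 F) :
    StrongContOn (strongDeriv F) := by
  intro x
  have h := ((contDiffOn_one_iff_derivWithin (uniqueDiffOn_Icc zero_lt_one)).1 (hF x)).2
  exact h.congr fun t ht =>
    ((hF.hasDerivWithinAt ht x).derivWithin (uniqueDiffOn_Icc zero_lt_one t ht)).symm

theorem of_hasDerivWithinAt {F' : ℝ → X →L[ℂ] X} (hF' : StrongContOn F')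
    (h : ∀ x, ∀ t ∈ I, HasDerivWithinAt (fun s => F s x) (F' t x) I t) : StrongC1 F := by
  intro x
  rw [contDiffOn_one_iff_derivWithin (uniqueDiffOn_Icc zero_lt_one)]
  refine ⟨fun t ht => (h x t ht).differentiableWithinAt, (hF' x).congr fun t ht => ?_⟩
  exact (h x t ht).derivWithin (uniqueDiffOn_Icc zero_lt_one t ht)

theorem hasDerivWithinAt_apply [CompleteSpace X] (hF : StrongC1 F) {t : ℝ} (ht : t ∈ I)
    {v : ℝ → X} {v' : X} (hv : HasDerivWithinAt v v' I t) :
    HasDerivWithinAt (fun s => F s (v s)) (strongDeriv F t (v t) + F t v') I t :=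
  hasDerivWithinAt_clm_apply hF.strongContOn ht (hF.hasDerivWithinAt ht) hv

theorem comp [CompleteSpace X] (hF : StrongC1 F) (hG : StrongC1 G) :
    StrongC1 (fun t => F t ∘L G t) := by
  refine of_hasDerivWithinAt (F' := fun t => strongDeriv F t ∘L G t + F t ∘L strongDeriv G t)
    ((hF.strongContOn_strongDeriv.comp hG.strongContOn).add
      (hF.strongContOn.comp hG.strongContOn_strongDeriv)) fun x t ht => ?_
  exact hF.hasDerivWithinAt_apply ht (hG.hasDerivWithinAt ht x)

theorem add (hF : StrongC1 F) (hG : StrongC1 G) : StrongC1 (fun t => F t + G t) :=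
  fun x => (hF x).add (hG x)

theorem sub (hF : StrongC1 F) (hG : StrongC1 G) : StrongC1 (fun t => F t - G t) :=
  fun x => (hF x).sub (hG x)

theorem neg (hF : StrongC1 F) : StrongC1 (fun t => - F t) :=
  fun x => (hF x).neg

theorem sum {ι : Type*} {s : Finset ι} {F : ι → ℝ → X →L[ℂ] X} (hF : ∀ i ∈ s, StrongC1 (F i)) :
    StrongC1 (fun t => ∑ i ∈ s, F i t) := by
  intro x
  simp only [sum_apply]
  exact ContDiffOn.sum fun i hi => hF i hi x

theorem smul {c : ℝ → ℂ} (hc : ContDiffOn ℝ 1 c I) (hF : StrongC1 F) :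
    StrongC1 (fun t => c t • F t) :=
  fun x => hc.smul (hF x)

theorem const (T : X →L[ℂ] X) : StrongC1 (fun _ => T) :=
  fun _ => contDiffOn_const

end StrongC1

/-- The strong derivative is determined by its defining property. -/
theorem StrongC1.strongDeriv_apply_eq [CompleteSpace X] {F : ℝ → X →L[ℂ] X} (hF : StrongC1 F)
    {t : ℝ} (ht : t ∈ I) {x y : X} (h : HasDerivWithinAt (fun s => F s x) y I t) :
    strongDeriv F t x = y :=
  (uniqueDiffOn_Icc zero_lt_one t ht).eq_deriv _ (hF.hasDerivWithinAt ht x) h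

/-- Differentiating `P ∘ P = P` gives `P' P + P P' = P'`. -/
theorem strongDeriv_comp_add_comp_strongDeriv [CompleteSpace X] {P : ℝ → X →L[ℂ] X}
    (hP : StrongC1 P) (hid : ∀ t ∈ I, P t ∘L P t = P t) {t : ℝ} (ht : t ∈ I) (x : X) :
    strongDeriv P t (P t x) + P t (strongDeriv P t x) = strongDeriv P t x := by
  have h1 := hP.hasDerivWithinAt_apply ht (hP.hasDerivWithinAt ht x)
  refine (hP.strongDeriv_apply_eq ht (h1.congr (fun s hs => ?_) ?_)).symm
  · exact (DFunLike.congr_fun (hid s hs) x).symm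
  · exact (DFunLike.congr_fun (hid t ht) x).symm

theorem apply_strongDeriv_apply_eq_zero [CompleteSpace X] {P : ℝ → X →L[ℂ] X}
    (hP : StrongC1 P) (hid : ∀ t ∈ I, P t ∘L P t = P t) {t : ℝ} (ht : t ∈ I) (x : X) :
    P t (strongDeriv P t (P t x)) = 0 := by
  have h1 := strongDeriv_comp_add_comp_strongDeriv hP hid ht (P t x)
  have h2 : ∀ y, P t (P t y) = P t y := fun y => DFunLike.congr_fun (hid t ht) y
  rw [h2] at h1
  simpa using h1

/-! ### Evolution systems and Duhamel's formula -/

namespace IsEvolutionSystem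

variable {A : ℝ → X →ₗ.[ℂ] X} {U : ℝ → ℝ → X →L[ℂ] X}

theorem continuousOn_snd (hU : IsEvolutionSystem A U) {t : ℝ} (ht : t ∈ I) (x : X) :
    ContinuousOn (fun s => U t s x) (Icc 0 t) := by
  refine (hU.continuousOn x).comp (f := fun s => (s, t)) (by fun_prop) fun s hs => ?_
  exact ⟨⟨hs.1, hs.2.trans ht.2⟩, ht, hs.2⟩

theorem apply_self (hU : IsEvolutionSystem A U) (hA : ∀ t ∈ I, Dense ((A t).domain : Set X))
    {t : ℝ} (ht : t ∈ I) (x : X) : U t t x = x := by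
  have key : ∀ s ∈ Ico (0 : ℝ) 1, ∀ x, U s s x = x := fun s hs x => by
    have := Continuous.ext_on (hA s ⟨hs.1, hs.2.le⟩) (U s s).continuous continuous_id
      fun y hy => hU.init s hs y hy
    exact congr_fun this x
  have hc : ContinuousOn (fun t => U t t x) I := by
    refine (hU.continuousOn x).comp (f := fun s => (s, s)) (by fun_prop) fun s hs => ?_
    exact ⟨hs, hs, le_rfl⟩
  -- the initial condition is imposed for `s < 1` only; the case `s = 1` follows by continuity
  have hs : Ico (0 : ℝ) 1 ⊆ I := Ico_subset_Icc_self
  refine Set.EqOn.of_subset_closure (f := fun t => U t t x) (g := fun _ => x)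
    (s := Ico (0 : ℝ) 1) (t := I) (fun s hs => key s hs x) hc continuousOn_const hs ?_ ht
  rw [closure_Ico zero_ne_one]

theorem comp_apply (hU : IsEvolutionSystem A U) {r s t : ℝ} (hr : 0 ≤ r) (hrs : r ≤ s)
    (hst : s ≤ t) (ht : t ≤ 1) (x : X) : U t s (U s r x) = U t r x := by
  refine DFunLike.congr_fun (hU.comp r s t ⟨⟨hr, ?_⟩, ⟨?_, ?_⟩, hrs⟩ ⟨⟨?_, ?_⟩, ⟨?_, ht⟩, hst⟩) x
  all_goals linarith

/-- The evolution applied to a differentiable curve `v` running in the domains has a derivative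
from the right with respect to the initial time. In general there is no two-sided derivative, as
`U s r y` need not be defined for `s < r`. -/
theorem hasDerivWithinAt_snd [CompleteSpace X] (hU : IsEvolutionSystem A U)
    (hA : ∀ t ∈ I, Dense ((A t).domain : Set X)) {t : ℝ} (ht : t ∈ I) {τ : ℝ} (hτ : τ ∈ Ico 0 t)
    {v : ℝ → X} {v' : X} (hv : HasDerivWithinAt v v' I τ) (hd : v τ ∈ (A τ).domain) :
    HasDerivWithinAt (fun σ => U t σ (v σ)) (U t τ (v' - A τ ⟨v τ, hd⟩)) (Ioi τ) τ := by
  have hτ1 : τ < 1 := hτ.2.trans_le ht.2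
  have hτI : τ ∈ I := ⟨hτ.1, hτ1.le⟩
  obtain ⟨C, -, hC⟩ := exists_bound_of_isCompact isCompact_Icc (hU.continuousOn_snd ht)
  have hIoc : Ioc τ t ∈ 𝓝[>] τ := Ioc_mem_nhdsGT hτ.2
  have hvr : HasDerivWithinAt v v' (Ioi τ) τ :=
    hv.mono_of_mem_nhdsWithin (mem_of_superset (Icc_mem_nhdsGT hτ1)
      (Icc_subset_Icc_left hτ.1))
  obtain ⟨hd', hUd⟩ := hU.solves τ ⟨hτ.1, hτ1⟩ (v τ) hd τ ⟨le_rfl, hτ1.le⟩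
  have hself : U τ τ (v τ) = v τ := hU.apply_self hA hτI _
  have hUd : HasDerivWithinAt (fun σ => U σ τ (v τ)) (A τ ⟨v τ, hd⟩) (Ioi τ) τ := by
    refine (hUd.mono_of_mem_nhdsWithin (Icc_mem_nhdsGT hτ1)).congr_deriv ?_
    congr 2
  have hsub := hvr.sub hUd
  rw [hasDerivWithinAt_iff_tendsto_slope' self_notMem_Ioi] at hsub ⊢
  have h2 : Tendsto (fun σ => U t σ (slope (v - fun σ => U σ τ (v τ)) τ σ)) (𝓝[>] τ)
      (𝓝 (U t τ (v' - A τ ⟨v τ, hd⟩))) := by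
    refine tendsto_clm_apply (C := C) ?_ ?_ hsub
    · filter_upwards [hIoc] with σ hσ using hC σ ⟨hτ.1.trans hσ.1.le, hσ.2⟩
    · have := hU.continuousOn_snd ht (v' - A τ ⟨v τ, hd⟩) τ ⟨hτ.1, hτ.2.le⟩
      refine this.mono_left (le_inf inf_le_left (le_principal_iff.2 ?_))
      exact mem_of_superset hIoc fun σ hσ => ⟨hτ.1.trans hσ.1.le, hσ.2⟩
  refine h2.congr' ?_
  filter_upwards [hIoc] with σ hσ
  simp only [slope, vsub_eq_sub, ContinuousLinearMap.map_smul_of_tower, Pi.sub_apply, hself,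
    sub_self, sub_zero, map_sub]
  rw [hU.comp_apply hτ.1 hσ.1.le hσ.2 ht.2]

/-- Duhamel's formula: if `v' = A v + g` with continuous `g`, then `v` differs from the evolution
of its initial value by the integral of `U t τ (g τ)`. -/
theorem duhamel [CompleteSpace X] (hU : IsEvolutionSystem A U)
    (hA : ∀ t ∈ I, Dense ((A t).domain : Set X)) {v g : ℝ → X} (hg : ContinuousOn g I)
    (hv : ∀ τ ∈ I, ∃ hd : v τ ∈ (A τ).domain,
      HasDerivWithinAt v (A τ ⟨v τ, hd⟩ + g τ) I τ) {t : ℝ} (ht : t ∈ I) :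
    v t - U t 0 (v 0) = ∫ τ in (0 : ℝ)..t, U t τ (g τ) := by
  have hsub : Icc 0 t ⊆ I := Icc_subset_Icc_right ht.2
  have hvc : ContinuousOn v I := fun τ hτ => (hv τ hτ).choose_spec.continuousWithinAt
  have h := intervalIntegral.integral_eq_sub_of_hasDeriv_right (a := 0) (b := t)
    (f := fun σ => U t σ (v σ)) (f' := fun τ => U t τ (g τ)) ?_ ?_ ?_
  · rw [h, hU.apply_self hA ht]
  · rw [uIcc_of_le ht.1]
    exact continuousOn_clm_apply isCompact_Icc (hU.continuousOn_snd ht) (hvc.mono hsub)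
  · intro τ hτ
    rw [min_eq_left ht.1, max_eq_right ht.1] at hτ
    obtain ⟨hd, hd'⟩ := hv τ (hsub ⟨hτ.1.le, hτ.2.le⟩)
    refine (hU.hasDerivWithinAt_snd hA ht ⟨hτ.1.le, hτ.2⟩ hd' hd).congr_deriv ?_
    simp
  · refine ContinuousOn.intervalIntegrable ?_
    rw [uIcc_of_le ht.1]
    exact continuousOn_clm_apply isCompact_Icc (hU.continuousOn_snd ht) (hg.mono hsub)

/-- An evolution system whose generator `A` satisfies `P' = A P - P A` on `D(A)` is adiabatic
with respect to `P`. -/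
theorem intertwines [CompleteSpace X] (hU : IsEvolutionSystem A U)
    (hA : ∀ t ∈ I, Dense ((A t).domain : Set X)) {P : ℝ → X →L[ℂ] X} (hP : StrongC1 P)
    (hPA : ∀ t ∈ I, ∀ y : (A t).domain, ∃ hd : P t y ∈ (A t).domain,
      A t ⟨P t y, hd⟩ = P t (A t y) + strongDeriv P t y) {t : ℝ} (ht : t ∈ I) (x : X) :
    U t 0 (P 0 x) = P t (U t 0 x) := by
  have h0 : (0 : ℝ) ∈ Ico (0 : ℝ) 1 := ⟨le_rfl, zero_lt_one⟩
  have h0I : (0 : ℝ) ∈ I := ⟨le_rfl, zero_le_one⟩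
  have key : ∀ x ∈ (A 0).domain, U t 0 (P 0 x) = P t (U t 0 x) := fun x hx => by
    have h := hU.duhamel hA (v := fun τ => P τ (U τ 0 x)) (g := fun _ => 0) continuousOn_const
      (fun τ hτ => ?_) ht
    · simp only [map_zero, intervalIntegral.integral_zero, sub_eq_zero] at h
      rw [h, hU.apply_self hA h0I]
    · obtain ⟨hd, hd'⟩ := hU.solves 0 h0 x hx τ hτ
      obtain ⟨hd2, hd2'⟩ := hPA τ hτ ⟨_, hd⟩
      refine ⟨hd2, (hP.hasDerivWithinAt_apply hτ hd').congr_deriv ?_⟩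
      rw [hd2', add_zero, add_comm]
  exact congr_fun (Continuous.ext_on (hA 0 h0I) ((U t 0).continuous.comp (P 0).continuous)
    ((P t).continuous.comp (U t 0).continuous) key) x

end IsEvolutionSystem

/-! ### Evolution systems for bounded generators -/

/-- The `n`-th term of the Dyson series of the generator `L`, started at time `s` in `x`. -/
noncomputable def dysonTerm (L : ℝ → X →L[ℂ] X) : ℕ → ℝ → ℝ → X → X
  | 0, _, _, x => x
  | n + 1, t, s, x => ∫ τ in s..t, L τ (dysonTerm L n τ s x)

section Dyson

variable {L : ℝ → X →L[ℂ] X} {C : ℝ}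

theorem continuous_clm_apply (hL : ∀ x, Continuous fun t => L t x) (hC : ∀ t, ‖L t‖ ≤ C)
    {α : Type*} [TopologicalSpace α] {τ : α → ℝ} {v : α → X} (hτ : Continuous τ)
    (hv : Continuous v) : Continuous fun a => L (τ a) (v a) :=
  continuous_iff_continuousAt.2 fun a =>
    tendsto_clm_apply (C := C) (Eventually.of_forall fun _ => hC _)
      (((hL (v a)).comp hτ).tendsto a) (hv.tendsto a)

theorem continuous_dysonTerm (hL : ∀ x, Continuous fun t => L t x) (hC : ∀ t, ‖L t‖ ≤ C)
    (n : ℕ) (x : X) : Continuous fun p : ℝ × ℝ => dysonTerm L n p.1 p.2 x := by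
  induction n with
  | zero => exact continuous_const
  | succ n ih =>
    have hi : ∀ p : ℝ × ℝ, Continuous fun τ => L τ (dysonTerm L n τ p.2 x) := fun p =>
      continuous_clm_apply hL hC continuous_id
        (ih.comp (by fun_prop : Continuous fun τ => (τ, p.2)))
    have hj : Continuous (Function.uncurry fun (p : ℝ × ℝ) τ => L τ (dysonTerm L n τ p.2 x)) :=
      continuous_clm_apply hL hC continuous_snd
        (ih.comp (by fun_prop : Continuous fun q : (ℝ × ℝ) × ℝ => (q.2, q.1.2)))
    have h1 := intervalIntegral.continuous_parametric_intervalIntegral_of_continuous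
      (μ := MeasureTheory.volume) (a₀ := 0) hj continuous_fst
    have h2 := intervalIntegral.continuous_parametric_intervalIntegral_of_continuous
      (μ := MeasureTheory.volume) (a₀ := 0) hj continuous_snd
    refine (h1.sub h2).congr fun p => ?_
    rw [Pi.sub_apply, intervalIntegral.integral_interval_sub_left ((hi p).intervalIntegrable _ _)
      ((hi p).intervalIntegrable _ _)]
    rfl

theorem continuous_clm_dysonTerm (hL : ∀ x, Continuous fun t => L t x) (hC : ∀ t, ‖L t‖ ≤ C)
    (n : ℕ) (s : ℝ) (x : X) : Continuous fun τ => L τ (dysonTerm L n τ s x) :=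
  continuous_clm_apply hL hC continuous_id
    ((continuous_dysonTerm hL hC n x).comp (by fun_prop : Continuous fun τ => (τ, s)))

theorem norm_dysonTerm_le (hC : ∀ t, ‖L t‖ ≤ C)
    (n : ℕ) {s t : ℝ} (hst : s ≤ t) (x : X) :
    ‖dysonTerm L n t s x‖ ≤ (C * (t - s)) ^ n / n.factorial * ‖x‖ := by
  have hC0 : 0 ≤ C := (norm_nonneg _).trans (hC 0)
  induction n generalizing t with
  | zero => simp [dysonTerm]
  | succ n ih =>
    have hb : ∀ τ ∈ Ioc s t, ‖L τ (dysonTerm L n τ s x)‖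
        ≤ C * ((C * (τ - s)) ^ n / n.factorial * ‖x‖) := fun τ hτ =>
      (L τ).le_of_opNorm_le (hC τ) _ |>.trans (mul_le_mul_of_nonneg_left (ih hτ.1.le) hC0)
    refine (intervalIntegral.norm_integral_le_of_norm_le hst (Eventually.of_forall hb)
      (Continuous.intervalIntegrable (by fun_prop) _ _)).trans (le_of_eq ?_)
    have h1 : ∀ τ : ℝ, C * ((C * (τ - s)) ^ n / n.factorial * ‖x‖)
        = (C ^ (n + 1) / n.factorial * ‖x‖) * (τ - s) ^ n := fun τ => by
      rw [mul_pow]; ring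
    simp only [h1]
    rw [intervalIntegral.integral_const_mul, intervalIntegral.integral_comp_sub_right
      (fun τ => τ ^ n), integral_pow, Nat.factorial_succ, sub_self]
    push_cast
    field_simp
    rw [zero_pow n.succ_ne_zero, sub_zero, mul_pow]
    ring

theorem dysonTerm_add (hL : ∀ x, Continuous fun t => L t x) (hC : ∀ t, ‖L t‖ ≤ C)
    (n : ℕ) (t s : ℝ) (x y : X) :
    dysonTerm L n t s (x + y) = dysonTerm L n t s x + dysonTerm L n t s y := by
  induction n generalizing t with
  | zero => rfl
  | succ n ih =>
    simp only [dysonTerm, ih, map_add]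
    exact intervalIntegral.integral_add
      ((continuous_clm_dysonTerm hL hC n s x).intervalIntegrable _ _)
      ((continuous_clm_dysonTerm hL hC n s y).intervalIntegrable _ _)

theorem dysonTerm_smul (n : ℕ) (t s : ℝ) (c : ℂ) (x : X) :
    dysonTerm L n t s (c • x) = c • dysonTerm L n t s x := by
  induction n generalizing t with
  | zero => rfl
  | succ n ih =>
    simp only [dysonTerm, ih, map_smul]
    exact intervalIntegral.integral_smul _ _

theorem norm_dysonTerm_le_of_mem_triangle (hC : ∀ t, ‖L t‖ ≤ C) (n : ℕ) {s t : ℝ}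
    (hst : (s, t) ∈ Triangle) (x : X) :
    ‖dysonTerm L n t s x‖ ≤ C ^ n / n.factorial * ‖x‖ := by
  have hC0 : 0 ≤ C := (norm_nonneg _).trans (hC 0)
  obtain ⟨hs, ht, h⟩ := hst
  refine (norm_dysonTerm_le hC n h x).trans ?_
  have h1 : C * (t - s) ≤ C := mul_le_of_le_one_right hC0 (by linarith [hs.1, ht.2])
  have h2 : 0 ≤ C * (t - s) := mul_nonneg hC0 (sub_nonneg.2 h)
  gcongr

theorem summable_dyson_bound (C c : ℝ) :
    Summable fun n : ℕ => C ^ n / n.factorial * c :=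
  (Real.summable_pow_div_factorial C).mul_right _

theorem summable_dysonTerm [CompleteSpace X] (hC : ∀ t, ‖L t‖ ≤ C) {s t : ℝ}
    (hst : (s, t) ∈ Triangle) (x : X) :
    Summable fun n => dysonTerm L n t s x :=
  (summable_dyson_bound C ‖x‖).of_norm_bounded
    fun n => norm_dysonTerm_le_of_mem_triangle hC n hst x

/-- The sum of the Dyson series solves the integral equation. -/
theorem tsum_dysonTerm_eq [CompleteSpace X] (hL : ∀ x, Continuous fun t => L t x)
    (hC : ∀ t, ‖L t‖ ≤ C) {s t : ℝ} (hst : (s, t) ∈ Triangle) (x : X) :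
    ∑' n, dysonTerm L n t s x = x + ∫ τ in s..t, L τ (∑' n, dysonTerm L n τ s x) := by
  have hC0 : 0 ≤ C := (norm_nonneg _).trans (hC 0)
  rw [(summable_dysonTerm hC hst x).tsum_eq_zero_add]
  congr 1
  refine HasSum.tsum_eq ?_
  have htri : ∀ τ ∈ uIoc s t, (s, τ) ∈ Triangle := fun τ hτ => by
    rw [uIoc_of_le hst.2.2] at hτ
    exact ⟨hst.1, ⟨hst.1.1.trans hτ.1.le, hτ.2.trans hst.2.1.2⟩, hτ.1.le⟩
  refine intervalIntegral.hasSum_integral_of_dominated_convergence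
    (fun n _ => C * (C ^ n / n.factorial * ‖x‖)) (fun n => ?_) (fun n => ?_) ?_ ?_ ?_
  · exact (continuous_clm_dysonTerm hL hC n s x).aestronglyMeasurable
  · refine Eventually.of_forall fun τ hτ => ?_
    exact ((L τ).le_of_opNorm_le (hC τ) _).trans (mul_le_mul_of_nonneg_left
      (norm_dysonTerm_le_of_mem_triangle hC n (htri τ hτ) x) hC0)
  · exact Eventually.of_forall fun τ hτ => (summable_dyson_bound C ‖x‖).mul_left C
  · exact intervalIntegrable_const
  · refine Eventually.of_forall fun τ hτ => ?_
    exact (summable_dysonTerm hC (htri τ hτ) x).hasSum.mapL (L τ)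

open Classical in
/-- The sum of the Dyson series as a bounded operator, extended by `0` outside the triangle `Δ`. -/
noncomputable def dyson [CompleteSpace X] (hL : ∀ x, Continuous fun t => L t x)
    (hC : ∀ t, ‖L t‖ ≤ C) (t s : ℝ) : X →L[ℂ] X :=
  if hst : (s, t) ∈ Triangle then
    LinearMap.mkContinuous
      { toFun := fun x => ∑' n, dysonTerm L n t s x
        map_add' := fun x y => by
          simp only [dysonTerm_add hL hC]
          exact (summable_dysonTerm hC hst x).tsum_add (summable_dysonTerm hC hst y)
        map_smul' := fun c x => by
          simp only [dysonTerm_smul, RingHom.id_apply]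
          exact (summable_dysonTerm hC hst x).tsum_const_smul c }
      (∑' n : ℕ, C ^ n / n.factorial) fun x => by
        have := tsum_of_norm_bounded (summable_dyson_bound C ‖x‖).hasSum
          fun n => norm_dysonTerm_le_of_mem_triangle hC n hst x
        rwa [tsum_mul_right] at this
  else 0

theorem dyson_apply [CompleteSpace X] (hL : ∀ x, Continuous fun t => L t x)
    (hC : ∀ t, ‖L t‖ ≤ C) {s t : ℝ} (hst : (s, t) ∈ Triangle) (x : X) :
    dyson hL hC t s x = ∑' n, dysonTerm L n t s x := by
  rw [dyson, dif_pos hst]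
  rfl

theorem continuousOn_dyson [CompleteSpace X] (hL : ∀ x, Continuous fun t => L t x)
    (hC : ∀ t, ‖L t‖ ≤ C) (x : X) :
    ContinuousOn (fun p : ℝ × ℝ => dyson hL hC p.2 p.1 x) Triangle := by
  have : ContinuousOn (fun p : ℝ × ℝ => ∑' n, dysonTerm L n p.2 p.1 x) Triangle :=
    continuousOn_tsum (fun n => ((continuous_dysonTerm hL hC n x).comp
      continuous_swap).continuousOn) (summable_dyson_bound C ‖x‖)
      fun n p hp => norm_dysonTerm_le_of_mem_triangle hC n hp x
  exact this.congr fun p hp => dyson_apply hL hC hp x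

theorem hasDerivWithinAt_dyson [CompleteSpace X] (hL : ∀ x, Continuous fun t => L t x)
    (hC : ∀ t, ‖L t‖ ≤ C) {s : ℝ} (hs : s ∈ Ico (0 : ℝ) 1) (x : X) {t : ℝ} (ht : t ∈ Icc s 1) :
    HasDerivWithinAt (fun τ => dyson hL hC τ s x) (L t (dyson hL hC t s x)) (Icc s 1) t := by
  have hmem : ∀ τ ∈ Icc s 1, (s, τ) ∈ Triangle := fun τ hτ =>
    ⟨⟨hs.1, hs.2.le⟩, ⟨hs.1.trans hτ.1, hτ.2⟩, hτ.1⟩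
  have hc : ContinuousOn (fun τ => dyson hL hC τ s x) (Icc s 1) :=
    (continuousOn_dyson hL hC x).comp (f := fun τ => (s, τ)) (by fun_prop) hmem
  -- extending the curve continuously to the whole line makes the fundamental theorem applicable
  let w : ℝ → X := IccExtend hs.2.le ((Icc s 1).domRestrict fun τ => dyson hL hC τ s x)
  have hw : Continuous w := hc.domRestrict.Icc_extend'
  have hweq : ∀ τ ∈ Icc s 1, w τ = dyson hL hC τ s x := fun τ hτ => IccExtend_of_mem _ _ hτ
  have hg : Continuous fun τ => L τ (w τ) := continuous_clm_apply hL hC continuous_id hw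
  have hd := (hg.integral_hasStrictDerivAt s t).hasDerivAt.hasDerivWithinAt (s := Icc s 1)
  rw [hweq t ht] at hd
  have heq : ∀ τ ∈ Icc s 1, dyson hL hC τ s x = x + ∫ σ in s..τ, L σ (w σ) := fun τ hτ => by
    rw [dyson_apply hL hC (hmem τ hτ), tsum_dysonTerm_eq hL hC (hmem τ hτ)]
    congr 1
    refine intervalIntegral.integral_congr fun σ hσ => ?_
    rw [uIcc_of_le hτ.1] at hσ
    have hσ' : σ ∈ Icc s 1 := ⟨hσ.1, hσ.2.trans hτ.2⟩
    simp only [hweq σ hσ', dyson_apply hL hC (hmem σ hσ')]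
  exact (hd.const_add x).congr heq (heq t ht)

theorem dyson_self [CompleteSpace X] (hL : ∀ x, Continuous fun t => L t x)
    (hC : ∀ t, ‖L t‖ ≤ C) {s : ℝ} (hs : s ∈ I) (x : X) : dyson hL hC s s x = x := by
  have h : (s, s) ∈ Triangle := ⟨hs, hs, le_rfl⟩
  rw [dyson_apply hL hC h, tsum_dysonTerm_eq hL hC h]
  simp

theorem dyson_comp [CompleteSpace X] (hL : ∀ x, Continuous fun t => L t x)
    (hC : ∀ t, ‖L t‖ ≤ C) {r s t : ℝ} (hrs : (r, s) ∈ Triangle) (hst : (s, t) ∈ Triangle) :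
    dyson hL hC t s ∘L dyson hL hC s r = dyson hL hC t r := by
  ext x
  rcases hst.1.2.eq_or_lt with hs1 | hs1
  · have : t = s := le_antisymm (hst.2.1.2.trans_eq hs1.symm) hst.2.2
    subst this
    exact dyson_self hL hC hst.1 _
  have hs : s ∈ Ico (0 : ℝ) 1 := ⟨hst.1.1, hs1⟩
  have hr : r ∈ Ico (0 : ℝ) 1 := ⟨hrs.1.1, hrs.2.2.trans_lt hs1⟩
  have hd : ∀ τ ∈ Icc s 1, HasDerivWithinAt
      (fun τ => dyson hL hC τ s (dyson hL hC s r x) - dyson hL hC τ r x)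
      (L τ (dyson hL hC τ s (dyson hL hC s r x) - dyson hL hC τ r x)) (Icc s 1) τ := fun τ hτ => by
    rw [map_sub]
    exact (hasDerivWithinAt_dyson hL hC hs _ hτ).sub
      ((hasDerivWithinAt_dyson hL hC hr x ⟨hrs.2.2.trans hτ.1, hτ.2⟩).mono
        (Icc_subset_Icc_left hrs.2.2))
  have := eq_zero_of_abs_deriv_le_mul_abs_self_of_eq_zero_right (K := C)
    (fun τ hτ => (hd τ hτ).continuousWithinAt)
    (fun τ hτ => (hd τ ⟨hτ.1, hτ.2.le⟩).mono_of_mem_nhdsWithin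
      (mem_of_superset (Icc_mem_nhdsGE hτ.2) (Icc_subset_Icc_left hτ.1)))
    (by rw [dyson_self hL hC hst.1, sub_self])
    (fun τ _ => (L τ).le_of_opNorm_le (hC τ) _) t ⟨hst.2.2, hst.2.1.2⟩
  exact sub_eq_zero.1 this

end Dyson

/-- Everywhere defined generators depending strongly continuously on time have an evolution
system. -/
theorem exists_isEvolutionSystem [CompleteSpace X] {L : ℝ → X →L[ℂ] X} (hL : StrongContOn L)
    {A : ℝ → X →ₗ.[ℂ] X} (hA : ∀ t ∈ I, ∀ y, ∃ hd : y ∈ (A t).domain, A t ⟨y, hd⟩ = L t y) :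
    ∃ V : ℝ → ℝ → X →L[ℂ] X, IsEvolutionSystem A V := by
  obtain ⟨C, -, hC⟩ := hL.exists_bound
  let L' : ℝ → X →L[ℂ] X := fun t => L (projIcc 0 1 zero_le_one t)
  have hL' : ∀ x, Continuous fun t => L' t x := fun x => (hL x).domRestrict.Icc_extend'
  have hC' : ∀ t, ‖L' t‖ ≤ C := fun t => hC _ (projIcc 0 1 zero_le_one t).2
  have hLL : ∀ t ∈ I, L' t = L t := fun t ht => by
    simp only [L', projIcc_of_mem zero_le_one ht]
  refine ⟨dyson hL' hC', ?_, ?_, ?_, ?_, continuousOn_dyson hL' hC'⟩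
  · exact fun s hs y _ => dyson_self hL' hC' ⟨hs.1, hs.2.le⟩ y
  · intro s hs y _
    have hu := uniqueDiffOn_Icc hs.2
    rw [contDiffOn_one_iff_derivWithin hu]
    have hd := fun t ht => hasDerivWithinAt_dyson hL' hC' hs y (t := t) ht
    refine ⟨fun t ht => (hd t ht).differentiableWithinAt, ?_⟩
    refine ContinuousOn.congr (f := fun t => L' t (dyson hL' hC' t s y))
      (continuousOn_clm_apply isCompact_Icc (fun x => (hL' x).continuousOn)
        fun t ht => (hd t ht).continuousWithinAt) fun t ht => (hd t ht).derivWithin (hu t ht)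
  · intro s hs y _ t ht
    have htI : t ∈ I := ⟨hs.1.trans ht.1, ht.2⟩
    obtain ⟨hm, he⟩ := hA t htI (dyson hL' hC' t s y)
    refine ⟨hm, ?_⟩
    rw [he, ← hLL t htI]
    exact hasDerivWithinAt_dyson hL' hC' hs y ht
  · exact fun r s t h1 h2 => dyson_comp hL' hC' h1 h2

/-! ### The nilpotent part and the reduced resolvent -/

/-- `P` is a bounded projection with `P X ⊂ D(A)` commuting with `A`, and `S` is the bounded
operator `(l - A) P`, which satisfies `S ^ m = 0`. -/
structure IsNilpotentPart (A : X →ₗ.[ℂ] X) (l : ℂ) (P S : X →L[ℂ] X) (m : ℕ) : Prop where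
  idem : ∀ y, P (P y) = P y
  apply_proj : ∀ y, ∃ hd : P y ∈ A.domain, A ⟨P y, hd⟩ = l • P y - S y
  proj_apply : ∀ y : A.domain, P (A y) = l • P y - S y
  proj_nil : ∀ y, P (S y) = S y
  nil_proj : ∀ y, S (P y) = S y
  pow_eq_zero : S ^ m = 0

/-- `R` is the reduced resolvent `(l + z - A)⁻¹ (1 - P)`. -/
structure IsReducedResolvent (A : X →ₗ.[ℂ] X) (l z : ℂ) (P R : X →L[ℂ] X) : Prop where
  apply_res : ∀ y, ∃ hd : R y ∈ A.domain, A ⟨R y, hd⟩ = l • R y - (y - P y - z • R y)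
  res_apply : ∀ y : A.domain, R (A y) = l • R y - (y - P y - z • R y)
  proj_res : ∀ y, P (R y) = 0
  res_proj : ∀ y, R (P y) = 0

theorem IsResolventAt.commutes {A : X →ₗ.[ℂ] X} {z : ℂ} {R P : X →L[ℂ] X}
    (hR : IsResolventAt A z R) (hP : CommutesWith P A) (y : X) : P (R y) = R (P y) := by
  obtain ⟨hd, he⟩ := hR.2 y
  obtain ⟨hd', he'⟩ := hP ⟨R y, hd⟩
  have h := hR.1 ⟨P (R y), hd'⟩
  simp only at h he'
  rw [he', ← map_smul, ← map_sub, he] at h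
  exact h.symm

theorem IsResolventAt.isReducedResolvent {A : X →ₗ.[ℂ] X} {l z : ℂ} {R P : X →L[ℂ] X}
    (hR : IsResolventAt A (l + z) R) (hP : CommutesWith P A) (hid : ∀ y, P (P y) = P y) :
    IsReducedResolvent A l z P (R ∘L (1 - P)) := by
  have hcompl : ∀ y, (1 - P) y = y - P y := fun _ => rfl
  refine ⟨fun y => ?_, fun y => ?_, fun y => ?_, fun y => ?_⟩
  · obtain ⟨hd, he⟩ := hR.2 ((1 - P) y)
    refine ⟨hd, ?_⟩
    rw [sub_eq_iff_eq_add'] at he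
    rw [eq_comm, sub_eq_iff_eq_add']
    simp only [ContinuousLinearMap.comp_apply, hcompl] at he ⊢
    rw [add_smul] at he
    rw [sub_add_eq_add_sub, eq_sub_iff_add_eq, he, add_comm]
  · have h1 := hR.1 y
    have h2 := congrArg (fun x => x - P x) h1
    simp only [hR.commutes hP, map_sub, map_smul, add_smul, map_add] at h2
    simp only [ContinuousLinearMap.comp_apply, hcompl, map_sub]
    rw [← h2]
    module
  · simp [hR.commutes hP, hid]
  · simp [hid]

/-- On `ker (A - l)^m` the resolvent is a polynomial in `z⁻¹` whose coefficients are the iterates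
`y k = (A - l)^k x`. -/
theorem exists_resolvent_expansion {A : X →ₗ.[ℂ] X} {l : ℂ} (m : ℕ) {x : X}
    (hx : x ∈ kerPow A l m) :
    ∃ y : ℕ → X, y 0 = x ∧ y m = 0 ∧ (∀ hd : x ∈ A.domain, 1 ≤ m → y 1 = A ⟨x, hd⟩ - l • x) ∧
      ∀ (z : ℂ) (R : X →L[ℂ] X), z ≠ 0 → IsResolventAt A (l + z) R →
        R x = ∑ k ∈ Finset.range m, (z⁻¹) ^ (k + 1) • y k := by
  induction m generalizing x with
  | zero =>
    have hx0 : x = 0 := hx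
    exact ⟨fun _ => x, rfl, hx0, fun _ h => absurd h (by simp), by simp [hx0]⟩
  | succ m ih =>
    obtain ⟨hd, hx'⟩ := hx
    obtain ⟨y, hy0, hym, -, hyR⟩ := ih hx'
    refine ⟨fun k => Nat.casesOn k x y, rfl, hym, fun _ _ => hy0, fun z R hz hR => ?_⟩
    have h1 := hR.1 ⟨x, hd⟩
    have h2 := hyR z R hz hR
    have h3 : R x = z⁻¹ • (x + R (A ⟨x, hd⟩ - l • x)) := by
      rw [eq_inv_smul_iff₀ hz]
      simp only [map_sub, map_smul, add_smul, map_add] at h1 ⊢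
      nth_rewrite 2 [← h1]
      abel
    rw [h3, h2, Finset.sum_range_succ', add_comm x, smul_add, Finset.smul_sum]
    congr 1
    · refine Finset.sum_congr rfl fun k _ => ?_
      rw [smul_smul, ← pow_succ']
    · simp

theorem exists_vandermonde_solution {n : ℕ} {u : Fin n → ℂ} (hu : Function.Injective u)
    (b : Fin n → ℂ) : ∃ c : Fin n → ℂ, ∀ k : Fin n, ∑ j, c j * u j ^ (k : ℕ) = b k := by
  have hdet : IsUnit (Matrix.vandermonde u).det :=
    isUnit_iff_ne_zero.2 (Matrix.det_vandermonde_ne_zero_iff.2 hu)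
  refine ⟨Matrix.vecMul b (Matrix.vandermonde u)⁻¹, fun k => ?_⟩
  have h := congr_fun (Matrix.vecMul_vecMul b (Matrix.vandermonde u)⁻¹ (Matrix.vandermonde u)) k
  rw [Matrix.nonsing_inv_mul _ hdet, Matrix.vecMul_one] at h
  exact h

/-- The operator `l - A` on `ker (A - l)^m` is a fixed linear combination of resolvents taken at
`m + 1` points of the ray `l + e (0, δ₀]`. -/
theorem exists_resolvent_combination {m : ℕ} (hm : 1 ≤ m) {δ₀ : ℝ} (hδ₀ : 0 < δ₀) :
    ∃ (c : Fin (m + 1) → ℂ) (δ : Fin (m + 1) → ℝ), (∀ j, δ j ∈ Ioc 0 δ₀) ∧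
      ∀ (A : X →ₗ.[ℂ] X) (l e : ℂ) (R : ℝ → X →L[ℂ] X), e ≠ 0 →
        (∀ j, IsResolventAt A (l + δ j * e) (R (δ j))) →
        ∀ x ∈ kerPow A l m, ∀ hd : x ∈ A.domain,
          e ^ 2 • ∑ j, c j • R (δ j) x = l • x - A ⟨x, hd⟩ := by
  let δ : Fin (m + 1) → ℝ := fun j => δ₀ / ((j : ℕ) + 1)
  have hδpos : ∀ j, 0 < δ j := fun j => by positivity
  have hδ : ∀ j, (δ j : ℂ) ≠ 0 := fun j => by exact_mod_cast (hδpos j).ne'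
  have hinj : Function.Injective fun j => ((δ j : ℂ))⁻¹ := fun i j hij => by
    have h1 : δ i = δ j := by exact_mod_cast inv_injective hij
    have h2 : ((i : ℕ) : ℝ) + 1 = (j : ℕ) + 1 := by
      simp only [δ] at h1
      field_simp at h1
      exact h1.symm
    exact Fin.ext (by exact_mod_cast add_right_cancel h2)
  -- with these coefficients only the term `k = 1`, that is `(A - l) x`, survives in the expansions
  obtain ⟨c, hc⟩ := exists_vandermonde_solution hinj fun k => if (k : ℕ) = 1 then (1 : ℂ) else 0
  refine ⟨fun j => -(c j * δ j), δ, fun j => ⟨hδpos j, ?_⟩, fun A l e R he hR x hx hd => ?_⟩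
  · exact div_le_self hδ₀.le (by simp)
  · obtain ⟨y, -, hym, hy1, hyR⟩ := exists_resolvent_expansion m hx
    have h1 : ∀ j, R (δ j) x
        = ∑ k ∈ Finset.range (m + 1), ((δ j * e : ℂ)⁻¹) ^ (k + 1) • y k := fun j => by
      rw [hyR _ _ (mul_ne_zero (hδ j) he) (hR j), Finset.sum_range_succ, hym, smul_zero, add_zero]
    have h2 : ∑ j, -(c j * δ j) • R (δ j) x = -(e⁻¹ ^ 2 • y 1) := by
      simp only [h1, Finset.smul_sum]
      rw [Finset.sum_comm]
      have h3 : ∀ k ∈ Finset.range (m + 1),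
          ∑ j, -(c j * δ j) • ((δ j * e : ℂ)⁻¹) ^ (k + 1) • y k
            = if k = 1 then -(e⁻¹ ^ 2 • y 1) else 0 := fun k hk => by
        have h4 := hc ⟨k, Finset.mem_range.1 hk⟩
        simp only at h4
        have h5 : ∀ j, -(c j * δ j) • ((δ j * e : ℂ)⁻¹) ^ (k + 1) • y k
            = (c j * (δ j : ℂ)⁻¹ ^ k) • (-(e⁻¹ ^ (k + 1) • y k)) := fun j => by
          rw [smul_neg, ← neg_smul, smul_smul, smul_smul, mul_inv, mul_pow, pow_succ (δ j : ℂ)⁻¹]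
          congr 1
          field_simp [hδ j]
        rw [Finset.sum_congr rfl fun j _ => h5 j, ← Finset.sum_smul, h4]
        split_ifs with hk1
        · rw [hk1, one_smul]
        · rw [zero_smul]
      rw [Finset.sum_congr rfl h3, Finset.sum_ite_eq' (Finset.range (m + 1)) 1, if_pos]
      exact Finset.mem_range.2 (by omega)
    rw [h2, hy1 hd hm, smul_neg, smul_smul, ← mul_pow, mul_inv_cancel₀ he, one_pow, one_smul,
      neg_sub]

theorem CommutesWith.isNilpotentPart {A : X →ₗ.[ℂ] X} {l : ℂ} {P S : X →L[ℂ] X} {m : ℕ}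
    (hm : 1 ≤ m) (hPA : CommutesWith P A) (hid : ∀ y, P (P y) = P y)
    (hker : ∀ y, P y ∈ kerPow A l m) (hS : ∀ y, ∀ hd : P y ∈ A.domain,
      S y = l • P y - A ⟨P y, hd⟩) : IsNilpotentPart A l P S m := by
  have hdom : ∀ y, P y ∈ A.domain := fun y => by
    obtain ⟨n, rfl⟩ : ∃ n, m = n + 1 := ⟨m - 1, by omega⟩
    exact (hker y).choose
  have hleft : ∀ y : A.domain, P (A y) = l • P y - S y := fun y => by
    obtain ⟨hd, he⟩ := hPA y
    rw [hS y hd, ← he]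
    abel
  have hSP : ∀ y, S (P y) = S y := fun y => by
    rw [hS y (hdom y), hS (P y) (by rw [hid]; exact hdom y)]
    simp only [hid]
  have hPS : ∀ y, P (S y) = S y := fun y => by
    rw [hS y (hdom y), map_sub, map_smul, hleft ⟨P y, hdom y⟩, hid, ← hS y (hdom y), hSP]
    simp
  refine ⟨hid, fun y => ⟨hdom y, by rw [hS y (hdom y)]; abel⟩, hleft, hPS, hSP, ?_⟩
  have key : ∀ n, ∀ x ∈ kerPow A l n, P x = x → (S ^ n) x = 0 := by
    intro n
    induction n with
    | zero => exact fun x (hx : x = 0) _ => by simp [hx]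
    | succ n ih =>
      rintro x ⟨hd, hx⟩ hPx
      have hSx : A ⟨x, hd⟩ - l • x = - S x := by
        have := hleft ⟨x, hd⟩
        obtain ⟨hd', he⟩ := hPA ⟨x, hd⟩
        simp only [hPx] at this he
        rw [he, this]
        abel
      rw [hSx] at hx
      have := ih _ hx (by rw [map_neg, hPS])
      rw [map_neg, neg_eq_zero] at this
      rw [pow_succ]
      exact this
  ext y
  obtain ⟨n, rfl⟩ : ∃ n, m = n + 1 := ⟨m - 1, by omega⟩
  have := key (n + 1) (P y) (hker y) (hid y)
  rw [pow_succ] at this ⊢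
  simpa [hSP] using this

/-! ### Operators of finite rank -/

/-- `G` has finite-dimensional range. -/
abbrev FiniteRank (G : X →L[ℂ] X) : Prop :=
  FiniteDimensional ℂ (LinearMap.range (G : X →ₗ[ℂ] X))

theorem FiniteRank.of_range_le {G H : X →L[ℂ] X} (hH : FiniteRank H) (f : X →L[ℂ] X)
    (h : ∀ y, ∃ z, G y = f (H z)) : FiniteRank G := by
  have hle : LinearMap.range (G : X →ₗ[ℂ] X)
      ≤ (LinearMap.range (H : X →ₗ[ℂ] X)).map (f : X →ₗ[ℂ] X) := by
    rintro _ ⟨y, rfl⟩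
    obtain ⟨z, hz⟩ := h y
    exact ⟨H z, ⟨z, rfl⟩, hz.symm⟩
  exact Submodule.finiteDimensional_of_le hle

theorem FiniteRank.exists_eq_sum {G : X →L[ℂ] X} (hG : FiniteRank G) :
    ∃ (n : ℕ) (φ : Fin n → X →L[ℂ] ℂ) (b : Fin n → X), ∀ y, G y = ∑ j, φ j y • b j := by
  let V := LinearMap.range (G : X →ₗ[ℂ] X)
  let G' : X →L[ℂ] V := G.codRestrict V fun y => ⟨y, rfl⟩
  let b := Module.finBasis ℂ V
  refine ⟨_, fun j => (LinearMap.toContinuousLinearMap (b.coord j)).comp G', fun j => b j,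
    fun y => ?_⟩
  have := congrArg (Subtype.val) (b.sum_repr (G' y))
  rw [AddSubmonoidClass.coe_finsetSum] at this
  exact this.symm

/-- Strong convergence to zero becomes norm convergence after composition with an operator of
finite rank on the right. -/
theorem FiniteRank.tendsto_norm_comp {ι : Type*} {f : Filter ι} {G : X →L[ℂ] X}
    (hG : FiniteRank G) {T : ι → X →L[ℂ] X} (hT : ∀ x, Tendsto (fun n => T n x) f (𝓝 0)) :
    Tendsto (fun n => ‖T n ∘L G‖) f (𝓝 0) := by
  obtain ⟨d, φ, b, hφ⟩ := hG.exists_eq_sum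
  have h : Tendsto (fun n => ∑ j, ‖φ j‖ * ‖T n (b j)‖) f (𝓝 0) := by
    have := tendsto_finsetSum (Finset.univ : Finset (Fin d)) fun j _ =>
      ((tendsto_zero_iff_norm_tendsto_zero.1 (hT (b j))).const_mul ‖φ j‖)
    simpa using this
  refine squeeze_zero (fun _ => norm_nonneg _) (fun n => ?_) h
  refine ContinuousLinearMap.opNorm_le_bound _ (by positivity) fun y => ?_
  simp only [ContinuousLinearMap.comp_apply, hφ, map_sum, map_smul, Finset.sum_mul]
  refine (norm_sum_le _ _).trans (Finset.sum_le_sum fun j _ => ?_)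
  rw [norm_smul, mul_right_comm]
  gcongr
  exact (φ j).le_opNorm y

/-- If every functional is mapped to a norm null sequence by the adjoints of `T n`, then
composing `T n` with an operator of finite rank on the left gives norm convergence to zero. -/
theorem FiniteRank.tendsto_comp_norm {ι : Type*} {f : Filter ι} {G : X →L[ℂ] X}
    (hG : FiniteRank G) {T : ι → X →L[ℂ] X}
    (hT : ∀ ψ : X →L[ℂ] ℂ, Tendsto (fun n => ψ ∘L T n) f (𝓝 0)) :
    Tendsto (fun n => ‖G ∘L T n‖) f (𝓝 0) := by
  obtain ⟨d, φ, b, hφ⟩ := hG.exists_eq_sum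
  have h : Tendsto (fun n => ∑ j, ‖φ j ∘L T n‖ * ‖b j‖) f (𝓝 0) := by
    have := tendsto_finsetSum (Finset.univ : Finset (Fin d)) fun j _ =>
      ((tendsto_zero_iff_norm_tendsto_zero.1 (hT (φ j))).mul_const ‖b j‖)
    simpa using this
  refine squeeze_zero (fun _ => norm_nonneg _) (fun n => ?_) h
  refine ContinuousLinearMap.opNorm_le_bound _ (by positivity) fun y => ?_
  simp only [ContinuousLinearMap.comp_apply, hφ, Finset.sum_mul]
  refine (norm_sum_le _ _).trans (Finset.sum_le_sum fun j _ => ?_)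
  rw [norm_smul, mul_right_comm]
  gcongr
  exact (φ j ∘L T n).le_opNorm y

theorem FiniteRank.of_norm_sub_lt_one {P Q : X →L[ℂ] X} (hQ : FiniteRank Q)
    (hid : ∀ y, P (P y) = P y) (h : ‖P - Q‖ < 1) : FiniteRank P := by
  let V := LinearMap.range (P : X →ₗ[ℂ] X)
  let f : V →ₗ[ℂ] LinearMap.range (Q : X →ₗ[ℂ] X) :=
    (Q : X →ₗ[ℂ] X).rangeRestrict ∘ₗ V.subtype
  refine FiniteDimensional.of_injective f ?_
  rw [← LinearMap.ker_eq_bot, LinearMap.ker_eq_bot']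
  rintro ⟨_, y, rfl⟩ hy
  have hy' : Q (P y) = 0 := congrArg Subtype.val hy
  have h1 : ‖P y‖ ≤ ‖P - Q‖ * ‖P y‖ := by
    have := (P - Q).le_opNorm (P y)
    rwa [sub_apply, hy', hid, sub_zero] at this
  have h2 : P y = 0 := by
    by_contra hne
    have := norm_pos_iff.2 hne
    nlinarith
  exact Subtype.ext h2

theorem StrongC1.norm_sub_le [CompleteSpace X] {F : ℝ → X →L[ℂ] X} (hF : StrongC1 F) :
    ∃ C, 0 < C ∧ (∀ t ∈ I, ‖strongDeriv F t‖ ≤ C) ∧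
      ∀ s ∈ I, ∀ t ∈ I, ‖F t - F s‖ ≤ C * |t - s| := by
  obtain ⟨C, hC0, hC⟩ := hF.strongContOn_strongDeriv.exists_bound
  refine ⟨C, hC0, hC, fun s hs t ht => ?_⟩
  refine ContinuousLinearMap.opNorm_le_bound _ (by positivity) fun x => ?_
  have := Convex.norm_image_sub_le_of_norm_hasDerivWithin_le (C := C * ‖x‖)
    (fun r hr => hF.hasDerivWithinAt hr x)
    (fun r hr => (strongDeriv F r).le_of_opNorm_le (hC r hr) x) (convex_Icc 0 1) hs ht
  rwa [mul_right_comm] at this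

/-- The rank of a projection depending strongly continuously differentiably on time stays
finite. -/
theorem StrongC1.finiteRank [CompleteSpace X] {P : ℝ → X →L[ℂ] X} (hP : StrongC1 P)
    (hid : ∀ t ∈ I, ∀ y, P t (P t y) = P t y) (h0 : FiniteRank (P 0)) {t : ℝ} (ht : t ∈ I) :
    FiniteRank (P t) := by
  obtain ⟨C, hC0, -, hC⟩ := hP.norm_sub_le
  have key : ∀ k : ℕ, ∀ t ∈ I, t ≤ k * (C + 1)⁻¹ → FiniteRank (P t) := by
    intro k
    induction k with
    | zero =>
      intro t ht htk
      have : t = 0 := le_antisymm (by simpa using htk) ht.1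
      rwa [this]
    | succ k ih =>
      intro t ht htk
      have hr : 0 < (C + 1)⁻¹ := by positivity
      have hs : max (t - (C + 1)⁻¹) 0 ∈ I :=
        ⟨le_max_right _ _, max_le (by linarith [ht.2]) zero_le_one⟩
      refine (ih _ hs (max_le ?_ (by positivity))).of_norm_sub_lt_one (hid t ht) ?_
      · push_cast at htk
        linarith
      · refine (hC _ hs t ht).trans_lt ?_
        have h1 : |t - max (t - (C + 1)⁻¹) 0| ≤ (C + 1)⁻¹ := by
          rw [abs_of_nonneg (sub_nonneg.2 (max_le (by linarith) ht.1))]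
          linarith [le_max_left (t - (C + 1)⁻¹) 0]
        calc C * |t - max (t - (C + 1)⁻¹) 0| ≤ C * (C + 1)⁻¹ := by gcongr
          _ < 1 := by rw [← div_eq_mul_inv, div_lt_one (by positivity)]; linarith
  obtain ⟨k, hk⟩ := exists_nat_ge (t * (C + 1))
  exact key k t ht (by rwa [← div_eq_mul_inv, le_div_iff₀ (by positivity)])

/-! ### Convergence of `δ R` as `δ` tends to zero -/

/-- For uniformly bounded operators, convergence to zero at a point passes to closures. -/
theorem tendsto_zero_of_mem_closure {E F : Type*} [NormedAddCommGroup E] [NormedSpace ℂ E]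
    [NormedAddCommGroup F] [NormedSpace ℂ F] {T : ℕ → E →L[ℂ] F} {C : ℝ} (hC : ∀ n, ‖T n‖ ≤ C)
    {s : Set E} (hs : ∀ x ∈ s, Tendsto (fun n => T n x) atTop (𝓝 0)) {x : E}
    (hx : x ∈ closure s) : Tendsto (fun n => T n x) atTop (𝓝 0) := by
  have hC0 : 0 ≤ C := (norm_nonneg _).trans (hC 0)
  rw [Metric.tendsto_atTop]
  intro η hη
  obtain ⟨y, hy, hxy⟩ := Metric.mem_closure_iff.1 hx (η / 2 / (C + 1)) (by positivity)
  obtain ⟨N, hN⟩ := Metric.tendsto_atTop.1 (hs y hy) (η / 2) (by positivity)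
  refine ⟨N, fun n hn => ?_⟩
  have h1 := hN n hn
  rw [dist_zero_right] at h1 ⊢
  rw [dist_eq_norm] at hxy
  have h2 : ‖T n (x - y)‖ ≤ C * (η / 2 / (C + 1)) :=
    ((T n).le_of_opNorm_le (hC n) _).trans (by gcongr)
  have h3 : C * (η / 2 / (C + 1)) ≤ η / 2 := by
    rw [← mul_div_assoc, div_le_iff₀ (by positivity)]
    nlinarith
  have h4 : T n x = T n (x - y) + T n y := by simp
  rw [h4]
  linarith [norm_add_le (T n (x - y)) (T n y)]

/-- The range condition for weakly associated projections makes `δ R` strongly convergent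
to zero. -/
theorem WeaklyAssociated.tendsto_smul_reducedResolvent {A : X →ₗ.[ℂ] X} {l e : ℂ}
    {P : X →L[ℂ] X} (h : WeaklyAssociated A l P) {δ : ℕ → ℝ} (hδ : ∀ n, 0 < δ n)
    (hδ0 : Tendsto δ atTop (𝓝 0)) (he : ‖e‖ = 1) {R : ℕ → X →L[ℂ] X}
    (hR : ∀ n, IsReducedResolvent A l (δ n * e) P (R n)) {M : ℝ} (hM : ∀ n, ‖R n‖ ≤ M / δ n)
    (x : X) : Tendsto (fun n => ((δ n : ℂ) • R n) x) atTop (𝓝 0) := by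
  have hid : ∀ y, P (P y) = P y := fun y => DFunLike.congr_fun h.idem y
  have hb : ∀ n, ‖(δ n : ℂ) • R n‖ ≤ M := fun n => by
    rw [norm_smul, Complex.norm_real, Real.norm_of_nonneg (hδ n).le]
    calc δ n * ‖R n‖ ≤ δ n * (M / δ n) := by gcongr; exacts [(hδ n).le, hM n]
      _ = M := mul_div_cancel₀ _ (hδ n).ne'
  have hx : ∀ n, ((δ n : ℂ) • R n) x = ((δ n : ℂ) • R n) (x - P x) := fun n => by
    simp [(hR n).res_proj]
  simp only [hx]
  refine tendsto_zero_of_mem_closure hb ?_ (h.dense_range (x - P x) (by simp [hid]))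
  rintro _ ⟨u, hu, rfl⟩
  have h1 : Tendsto (fun n => δ n * ((M + 1) * ‖(u : X)‖)) atTop (𝓝 0) := by
    simpa using hδ0.mul_const ((M + 1) * ‖(u : X)‖)
  refine squeeze_zero_norm (fun n => ?_) h1
  have h2 : ((δ n : ℂ) • R n) (A u - l • (u : X))
      = (δ n : ℂ) • (e • ((δ n : ℂ) • R n) u - u) := by
    simp only [smul_apply, map_sub, map_smul, (hR n).res_apply u, hu]
    module
  rw [h2, norm_smul, Complex.norm_real, Real.norm_of_nonneg (hδ n).le]
  refine mul_le_mul_of_nonneg_left ((norm_sub_le _ _).trans ?_) (hδ n).le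
  rw [norm_smul, he, one_mul, add_mul, one_mul]
  gcongr
  exact (ContinuousLinearMap.le_of_opNorm_le _ (hb n) _)

/-- A vector outside a closed subspace is separated from it by a continuous functional. -/
theorem exists_functional_of_notMem {E : Type*} [NormedAddCommGroup E] [NormedSpace ℂ E]
    {p : Submodule ℂ E} (hp : IsClosed (p : Set E)) {x : E} (hx : x ∉ p) :
    ∃ f : E →L[ℂ] ℂ, f x ≠ 0 ∧ ∀ y ∈ p, f y = 0 := by
  have : IsClosed (p : Set E) := hp
  have hne : p.mkQ x ≠ 0 := by simpa using hx
  obtain ⟨f, hf⟩ := SeparatingDual.exists_ne_zero (R := ℂ) hne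
  refine ⟨f ∘L p.mkQL, hf, fun y hy => ?_⟩
  have : p.mkQ y = 0 := by simpa using hy
  change f (p.mkQ y) = 0
  rw [this, map_zero]

/-- In reflexive spaces the injectivity condition for weakly associated projections makes the
adjoints of `δ R` strongly convergent to zero: a functional on the dual space that annihilates all
functionals for which convergence holds is given by a vector in `ker (A - l)` on which `P`
vanishes. -/
theorem WeaklyAssociated.tendsto_comp_smul_reducedResolvent (hX : Reflexive X)
    {A : X →ₗ.[ℂ] X} {l e : ℂ}
    {P : X →L[ℂ] X} (h : WeaklyAssociated A l P) {δ : ℕ → ℝ} (hδ : ∀ n, 0 < δ n)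
    (hδ0 : Tendsto δ atTop (𝓝 0)) (he : ‖e‖ = 1) {R : ℕ → X →L[ℂ] X}
    (hR : ∀ n, IsReducedResolvent A l (δ n * e) P (R n)) {M : ℝ} (hM : ∀ n, ‖R n‖ ≤ M / δ n)
    (ψ : X →L[ℂ] ℂ) : Tendsto (fun n => ψ ∘L ((δ n : ℂ) • R n)) atTop (𝓝 0) := by
  have hid : ∀ y, P (P y) = P y := fun y => DFunLike.congr_fun h.idem y
  have hb : ∀ n, ‖(δ n : ℂ) • R n‖ ≤ M := fun n => by
    rw [norm_smul, Complex.norm_real, Real.norm_of_nonneg (hδ n).le]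
    calc δ n * ‖R n‖ ≤ δ n * (M / δ n) := by gcongr; exacts [(hδ n).le, hM n]
      _ = M := mul_div_cancel₀ _ (hδ n).ne'
  -- the adjoint of `T` as an operator on the dual space
  let T' : ℕ → (X →L[ℂ] ℂ) →L[ℂ] (X →L[ℂ] ℂ) := fun n =>
    (ContinuousLinearMap.compL ℂ X X ℂ).flip ((δ n : ℂ) • R n)
  have hT' : ∀ n ψ, T' n ψ = ψ ∘L ((δ n : ℂ) • R n) := fun n ψ => rfl
  have hM0 : 0 ≤ M := (norm_nonneg _).trans (hb 0)
  have hb' : ∀ n, ‖T' n‖ ≤ M := fun n => by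
    refine ContinuousLinearMap.opNorm_le_bound _ hM0 fun ψ => ?_
    rw [hT', mul_comm]
    exact (ContinuousLinearMap.opNorm_comp_le _ _).trans (by gcongr; exact hb n)
  let p : Submodule ℂ (X →L[ℂ] ℂ) :=
    { carrier := {ψ | Tendsto (fun n => T' n ψ) atTop (𝓝 0)}
      add_mem' := fun {ψ χ} h1 h2 => by
        have := Tendsto.add h1 h2
        simpa only [mem_ofPred_eq, map_add, add_zero] using this
      zero_mem' := by simp
      smul_mem' := fun c ψ h1 => by
        have h1' : Tendsto (fun n => T' n ψ) atTop (𝓝 0) := h1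
        have h2 : Tendsto (fun n => c • T' n ψ) atTop (𝓝 0) :=
          (by ext; simp : c • (0 : X →L[ℂ] ℂ) = 0) ▸ h1'.const_smul c
        simpa only [mem_ofPred_eq, map_smul] using h2 }
  have hp : IsClosed (p : Set (X →L[ℂ] ℂ)) :=
    isClosed_of_closure_subset fun ψ hψ => tendsto_zero_of_mem_closure hb' (fun _ h => h) hψ
  suffices ψ ∈ p from this
  by_contra hψ
  obtain ⟨f, hf, hfp⟩ := exists_functional_of_notMem hp hψ
  obtain ⟨x, rfl⟩ := hX f
  have hfp' : ∀ χ ∈ p, χ x = 0 := hfp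
  apply hf
  change ψ x = 0
  have hPx : P x = 0 := by
    by_contra hne
    obtain ⟨χ, hχ⟩ := SeparatingDual.exists_ne_zero (R := ℂ) hne
    refine hχ (hfp' (χ ∘L P) ?_)
    have h0 : ∀ n, T' n (χ ∘L P) = 0 := fun n => by
      ext y
      simp [hT', (hR n).proj_res]
    change Tendsto _ _ _
    simp only [h0, tendsto_const_nhds]
  have hx : x = ((δ 0 : ℂ) * e) • R 0 x := by
    rw [← sub_eq_zero]
    by_contra hne
    obtain ⟨χ, hχ⟩ := SeparatingDual.exists_ne_zero (R := ℂ) hne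
    let χ' : X →L[ℂ] ℂ := χ ∘L (1 - P - ((δ 0 : ℂ) * e) • R 0)
    have hχ' : ∀ y, χ' y = χ (y - P y - ((δ 0 : ℂ) * e) • R 0 y) := fun y => rfl
    refine hχ ?_
    have h0 := hfp' χ' ?_
    · rwa [hχ', hPx, sub_zero] at h0
    -- `(1 - P - δ₀ e R₀) R_n = R₀ (l - A) R_n` is bounded in `n`
    have h1 : Tendsto (fun n => δ n * (‖χ ∘L R 0‖ * (1 + ‖P‖ + M))) atTop (𝓝 0) := by
      simpa using hδ0.mul_const (‖χ ∘L R 0‖ * (1 + ‖P‖ + M))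
    refine squeeze_zero_norm (fun n => ?_) h1
    have hn : 0 ≤ δ n := (hδ n).le
    refine ContinuousLinearMap.opNorm_le_bound _ (by positivity) fun y => ?_
    obtain ⟨hd, hA⟩ := (hR n).apply_res y
    have h2 := (hR 0).res_apply ⟨R n y, hd⟩
    rw [hA] at h2
    have h3 : T' n χ' y = (δ n : ℂ) • (χ ∘L R 0) (y - P y - e • ((δ n : ℂ) • R n) y) := by
      rw [hT', ContinuousLinearMap.comp_apply, smul_apply, map_smul, hχ']
      congr 1
      rw [ContinuousLinearMap.comp_apply]
      congr 1
      simp only [map_sub, map_smul] at h2 ⊢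
      have h4 : R n y - P (R n y) - ((δ 0 : ℂ) * e) • R 0 (R n y)
        = l • R 0 (R n y) - (l • R 0 (R n y) - (R 0 y - R 0 (P y)
          - ((δ n : ℂ) * e) • R 0 (R n y))) := by
        rw [h2]; abel
      rw [h4]
      module
    rw [h3, norm_smul, Complex.norm_real, Real.norm_of_nonneg hn, mul_assoc, mul_assoc]
    refine mul_le_mul_of_nonneg_left (((χ ∘L R 0).le_opNorm _).trans ?_) hn
    refine mul_le_mul_of_nonneg_left ?_ (norm_nonneg _)
    refine (norm_sub_le _ _).trans ?_
    rw [add_mul, add_mul, one_mul, norm_smul, he, one_mul]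
    refine add_le_add ((norm_sub_le _ _).trans ?_)
      (ContinuousLinearMap.le_of_opNorm_le _ (hb n) _)
    gcongr
    exact P.le_opNorm y
  obtain ⟨hd, hA⟩ := (hR 0).apply_res x
  have hd' : x ∈ A.domain := by
    rw [hx]
    exact A.domain.smul_mem _ hd
  have hAx : A ⟨x, hd'⟩ = l • x := by
    have h1 : (⟨x, hd'⟩ : A.domain) = ((δ 0 : ℂ) * e) • ⟨R 0 x, hd⟩ := Subtype.ext hx
    rw [h1, LinearPMap.map_smul, hA, hPx, ← hx, sub_zero, sub_self, sub_zero, smul_comm, ← hx]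
  have := h.injective ⟨x, hd'⟩ hPx hAx
  simp only at this
  rw [this, map_zero]

/-! ### Integrated operator norms -/

/-- The norm of a strongly continuous operator family is lower semicontinuous, hence
measurable. -/
theorem StrongContOn.aemeasurable_enorm {F : ℝ → X →L[ℂ] X} (hF : StrongContOn F) :
    AEMeasurable (fun t => ‖F t‖ₑ) (volume.restrict I) := by
  let F' : ℝ → X →L[ℂ] X := fun t => F (projIcc 0 1 zero_le_one t)
  have hF' : ∀ x, Continuous fun t => F' t x := fun x => (hF x).domRestrict.Icc_extend'
  have hl : LowerSemicontinuous fun t => ‖F' t‖ := by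
    intro t y hy
    obtain ⟨x, hx, hyx⟩ := (F' t).exists_lt_apply_of_lt_opNorm hy
    filter_upwards [(hF' x).norm.tendsto t |>.eventually (lt_mem_nhds hyx)] with s hs
    exact hs.trans_le ((F' s).unit_le_opNorm x hx.le)
  have hm : Measurable fun t => ‖F' t‖ₑ := by
    have := hl.measurable.ennreal_ofReal
    simpa only [ofReal_norm] using this
  refine hm.aemeasurable.congr ?_
  filter_upwards [ae_restrict_mem measurableSet_Icc] with t ht
  simp only [F', projIcc_of_mem zero_le_one ht]

theorem enorm_clm_zero : ‖(0 : X →L[ℂ] X)‖ₑ = 0 := by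
  rw [← ofReal_norm, norm_zero, ENNReal.ofReal_zero]

theorem enorm_clm_add_le (F G : X →L[ℂ] X) : ‖F + G‖ₑ ≤ ‖F‖ₑ + ‖G‖ₑ := by
  rw [← ofReal_norm, ← ofReal_norm, ← ofReal_norm,
    ← ENNReal.ofReal_add (norm_nonneg _) (norm_nonneg _)]
  exact ENNReal.ofReal_le_ofReal (norm_add_le _ _)

theorem tendsto_lintegral_enorm {T : ℕ → ℝ → X →L[ℂ] X} (hT : ∀ n, StrongContOn (T n)) {C : ℝ}
    (hC : ∀ n, ∀ t ∈ I, ‖T n t‖ ≤ C)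
    (h : ∀ᵐ t ∂(volume.restrict I), Tendsto (fun n => ‖T n t‖) atTop (𝓝 0)) :
    Tendsto (fun n => ∫⁻ t in I, ‖T n t‖ₑ) atTop (𝓝 0) := by
  have := tendsto_lintegral_of_dominated_convergence' (μ := volume.restrict I)
    (F := fun n t => ‖T n t‖ₑ) (f := fun _ => 0) (fun _ => ENNReal.ofReal C)
    (fun n => (hT n).aemeasurable_enorm) (fun n => ?_) ?_ ?_
  · simpa using this
  · filter_upwards [ae_restrict_mem measurableSet_Icc] with t ht
    rw [← ofReal_norm]
    exact ENNReal.ofReal_le_ofReal (hC n t ht)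
  · rw [setLIntegral_const]
    simp
  · filter_upwards [h] with t ht
    have := ENNReal.tendsto_ofReal ht
    simpa only [ofReal_norm, ENNReal.ofReal_zero] using this

/-! ### Difference quotients -/

/-- Difference quotients with step `h` which only involve points of `I`. -/
noncomputable def diffQuot {E : Type*} [AddCommGroup E] [Module ℝ E] (f : ℝ → E) (h t : ℝ) : E :=
  h⁻¹ • (f ((1 - h) * t + h) - f ((1 - h) * t))

theorem mapsTo_add_mul {h : ℝ} (hh : h ∈ Icc (0 : ℝ) 1) :
    MapsTo (fun t => (1 - h) * t + h) I I := fun t ht => by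
  constructor <;> simp only [] <;> nlinarith [ht.1, ht.2, hh.1, hh.2]

theorem mapsTo_mul {h : ℝ} (hh : h ∈ Icc (0 : ℝ) 1) :
    MapsTo (fun t => (1 - h) * t) I I := fun t ht => by
  constructor <;> simp only [] <;> nlinarith [ht.1, ht.2, hh.1, hh.2]

theorem tendsto_diffQuot {E : Type*} [NormedAddCommGroup E] [NormedSpace ℝ E] {f : ℝ → E} {f' : E}
    {t : ℝ} (ht : t ∈ I) (hf : HasDerivWithinAt f f' I t) :
    Tendsto (fun h => diffQuot f h t) (𝓝[Ioc 0 1] 0) (𝓝 f') := by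
  have ho := hasDerivWithinAt_iff_isLittleO.1 hf
  have hmem : ∀ᶠ h : ℝ in 𝓝[Ioc 0 1] 0, h ∈ Ioc (0 : ℝ) 1 := self_mem_nhdsWithin
  -- along both families of points the remainder is `o(h)`
  have aux : ∀ φ : ℝ → ℝ, Continuous φ → φ 0 = t → (∀ h ∈ Ioc (0 : ℝ) 1, φ h ∈ I) →
      (∀ h ∈ Ioc (0 : ℝ) 1, |φ h - t| ≤ h) →
      (fun h => f (φ h) - f t - (φ h - t) • f') =o[𝓝[Ioc 0 1] 0] fun h => h := by
    intro φ hφ hφ0 hφI hφh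
    have ht : Tendsto φ (𝓝[Ioc 0 1] 0) (𝓝[I] t) := by
      refine tendsto_nhdsWithin_iff.2 ⟨?_, hmem.mono hφI⟩
      exact (hφ0 ▸ hφ.tendsto 0).mono_left inf_le_left
    refine (ho.comp_tendsto ht).trans_isBigO (Asymptotics.IsBigO.of_bound 1 ?_)
    filter_upwards [hmem] with h hh
    rw [one_mul, Real.norm_of_nonneg hh.1.le]
    exact hφh h hh
  have h1 := aux (fun h => (1 - h) * t + h) (by fun_prop) (by simp)
    (fun h hh => mapsTo_add_mul ⟨hh.1.le, hh.2⟩ ht) fun h hh => by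
      rw [abs_le]; constructor <;> nlinarith [hh.1, ht.1, ht.2]
  have h2 := aux (fun h => (1 - h) * t) (by fun_prop) (by simp)
    (fun h hh => mapsTo_mul ⟨hh.1.le, hh.2⟩ ht) fun h hh => by
      rw [abs_le]; constructor <;> nlinarith [hh.1, ht.1, ht.2]
  have h3 := (h1.sub h2).tendsto_inv_smul_nhds_zero
  rw [← zero_add f']
  refine (h3.add_const f').congr' ?_
  filter_upwards [hmem] with h hh
  have : f ((1 - h) * t + h) - f t - ((1 - h) * t + h - t) • f'
      - (f ((1 - h) * t) - f t - ((1 - h) * t - t) • f')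
      = f ((1 - h) * t + h) - f ((1 - h) * t) - h • f' := by module
  rw [this, diffQuot, smul_sub _ _ (h • f'), inv_smul_smul₀ hh.1.ne', sub_add_cancel]

theorem StrongC1.diffQuot {F : ℝ → X →L[ℂ] X} (hF : StrongC1 F) {h : ℝ} (hh : h ∈ Ioc (0 : ℝ) 1) :
    StrongC1 (diffQuot F h) := by
  intro x
  have hh' : h ∈ Icc (0 : ℝ) 1 := ⟨hh.1.le, hh.2⟩
  have h1 : ContDiffOn ℝ 1 (fun t => F ((1 - h) * t + h) x) I :=
    (hF x).comp (by fun_prop) (mapsTo_add_mul hh')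
  have h2 : ContDiffOn ℝ 1 (fun t => F ((1 - h) * t) x) I :=
    (hF x).comp (by fun_prop) (mapsTo_mul hh')
  exact (h1.sub h2).const_smul h⁻¹

theorem norm_diffQuot_le {F : ℝ → X →L[ℂ] X} {C : ℝ}
    (hC : ∀ s ∈ I, ∀ t ∈ I, ‖F t - F s‖ ≤ C * |t - s|) {h : ℝ} (hh : h ∈ Ioc (0 : ℝ) 1)
    {t : ℝ} (ht : t ∈ I) : ‖diffQuot F h t‖ ≤ C := by
  have hh' : h ∈ Icc (0 : ℝ) 1 := ⟨hh.1.le, hh.2⟩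
  have h1 := hC _ (mapsTo_mul hh' ht) _ (mapsTo_add_mul hh' ht)
  rw [add_sub_cancel_left, abs_of_pos hh.1] at h1
  rw [diffQuot, norm_smul, norm_inv, Real.norm_of_nonneg hh.1.le, inv_mul_le_iff₀ hh.1]
  exact h1.trans_eq (mul_comm _ _)

theorem tendsto_one_div_add_one_nhdsWithin :
    Tendsto (fun n : ℕ => 1 / ((n : ℝ) + 1)) atTop (𝓝[Ioc 0 1] 0) := by
  refine tendsto_nhdsWithin_iff.2 ⟨tendsto_one_div_add_atTop_nhds_zero_nat, ?_⟩
  refine Eventually.of_forall fun n => ⟨by positivity, ?_⟩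
  rw [div_le_one (by positivity)]
  simp

theorem one_div_add_one_mem (n : ℕ) : 1 / ((n : ℝ) + 1) ∈ Ioc (0 : ℝ) 1 := by
  refine ⟨by positivity, ?_⟩
  rw [div_le_one (by positivity)]
  simp

/-! ### The spectral data -/

/-- The data along `I` entering the adiabatic theorem: projections `P t` of finite rank commuting
with `A t`, the nilpotent operators `S t = (l t - A t) P t`, and the reduced resolvents
`R δ t = (l t + δ e t - A t)⁻¹ (1 - P t)` along a ray, of norm at most `M₀ / δ`. -/
structure SpectralData (A : ℝ → X →ₗ.[ℂ] X) (l e : ℝ → ℂ) (P S : ℝ → X →L[ℂ] X)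
    (R : ℝ → ℝ → X →L[ℂ] X) (m : ℕ) (δ₀ M₀ : ℝ) : Prop where
  pos : 0 < δ₀
  norm_dir : ∀ t, ‖e t‖ = 1
  continuousOn_dir : ContinuousOn e I
  assoc : ∀ᵐ t ∂(volume.restrict I), WeaklyAssociated (A t) (l t) (P t)
  nilpotent : ∀ t ∈ I, IsNilpotentPart (A t) (l t) (P t) (S t) m
  reduced : ∀ δ ∈ Ioc 0 δ₀, ∀ t ∈ I, IsReducedResolvent (A t) (l t) (δ * e t) (P t) (R δ t)
  norm_reduced : ∀ δ ∈ Ioc 0 δ₀, ∀ t ∈ I, ‖R δ t‖ ≤ M₀ / δ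
  finiteRank : ∀ t ∈ I, FiniteRank (P t)
  contDiff_proj : StrongC1 P
  contDiff_nil : StrongC1 S
  contDiff_reduced : ∀ δ ∈ Ioc 0 δ₀, StrongC1 (R δ)

namespace SpectralData

variable {A : ℝ → X →ₗ.[ℂ] X} {l e : ℝ → ℂ} {P S : ℝ → X →L[ℂ] X} {R : ℝ → ℝ → X →L[ℂ] X}
  {m : ℕ} {δ₀ M₀ : ℝ}

theorem norm_smul_reduced (h : SpectralData A l e P S R m δ₀ M₀) {δ : ℝ} (hδ : δ ∈ Ioc 0 δ₀)
    {t : ℝ} (ht : t ∈ I) : ‖(δ * e t : ℂ) • R δ t‖ ≤ M₀ := by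
  rw [norm_smul, norm_mul, h.norm_dir, mul_one, Complex.norm_real, Real.norm_of_nonneg hδ.1.le]
  calc δ * ‖R δ t‖ ≤ δ * (M₀ / δ) := by gcongr; exacts [hδ.1.le, h.norm_reduced δ hδ t ht]
    _ = M₀ := mul_div_cancel₀ _ hδ.1.ne'

theorem strongContOn_smul_reduced (h : SpectralData A l e P S R m δ₀ M₀) {δ : ℝ}
    (hδ : δ ∈ Ioc 0 δ₀) : StrongContOn fun t => (δ * e t : ℂ) • R δ t :=
  .smul (h.continuousOn_dir.const_smul (δ : ℂ)) (h.contDiff_reduced δ hδ).strongContOn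

/-- The sequence `δ₀ / (n + 1)` stays in the admissible range. -/
theorem seq_mem (h : SpectralData A l e P S R m δ₀ M₀) (n : ℕ) :
    δ₀ * (1 / ((n : ℝ) + 1)) ∈ Ioc 0 δ₀ :=
  ⟨mul_pos h.pos (one_div_add_one_mem n).1,
    mul_le_of_le_one_right h.pos.le (one_div_add_one_mem n).2⟩

theorem seq_tendsto (δ₀ : ℝ) : Tendsto (fun n : ℕ => δ₀ * (1 / ((n : ℝ) + 1))) atTop (𝓝 0) := by
  simpa using (tendsto_one_div_add_atTop_nhds_zero_nat (𝕜 := ℝ)).const_mul δ₀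

/-- For `G = G P` the integral of `‖δ e R G‖` is small for a suitable `δ`. -/
theorem exists_lintegral_comp_le [CompleteSpace X] (h : SpectralData A l e P S R m δ₀ M₀)
    {G : ℝ → X →L[ℂ] X} (hG : StrongContOn G) (hGP : ∀ t ∈ I, ∀ y, G t (P t y) = G t y)
    {η : ENNReal} (hη : 0 < η) :
    ∃ δ ∈ Ioc 0 δ₀, ∫⁻ t in I, ‖((δ * e t : ℂ) • R δ t) ∘L G t‖ₑ ≤ η := by
  obtain ⟨C, hC0, hC⟩ := hG.exists_bound
  have key := tendsto_lintegral_enorm (C := M₀ * C)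
    (T := fun n t => (((δ₀ * (1 / ((n : ℝ) + 1)) : ℝ) * e t : ℂ)
      • R (δ₀ * (1 / ((n : ℝ) + 1))) t) ∘L G t)
    (fun n => (h.strongContOn_smul_reduced (h.seq_mem n)).comp hG) (fun n t ht => ?_) ?_
  · obtain ⟨n, hn⟩ := (ENNReal.tendsto_nhds_zero.1 key η hη).exists
    exact ⟨_, h.seq_mem n, hn⟩
  · refine (ContinuousLinearMap.opNorm_comp_le _ _).trans ?_
    have h1 := h.norm_smul_reduced (h.seq_mem n) ht
    exact mul_le_mul h1 (hC t ht) (norm_nonneg _) ((norm_nonneg _).trans h1)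
  · filter_upwards [h.assoc, ae_restrict_mem measurableSet_Icc] with t hat ht
    have hfr : FiniteRank (G t) :=
      (h.finiteRank t ht).of_range_le (G t) fun y => ⟨y, (hGP t ht y).symm⟩
    refine hfr.tendsto_norm_comp fun x => ?_
    have := (hat.tendsto_smul_reducedResolvent (fun n => (h.seq_mem n).1) (seq_tendsto δ₀)
      (h.norm_dir t) (fun n => h.reduced _ (h.seq_mem n) t ht)
      (fun n => h.norm_reduced _ (h.seq_mem n) t ht) x).const_smul (e t)
    rw [smul_zero] at this
    refine this.congr fun n => ?_
    rw [smul_apply, smul_apply, smul_smul, mul_comm]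

/-- In reflexive spaces, and for `G = P G`, the integral of `‖G δ e R‖` is small for a
suitable `δ`. -/
theorem exists_lintegral_comp_le' [CompleteSpace X] (hX : Reflexive X)
    (h : SpectralData A l e P S R m δ₀ M₀)
    {G : ℝ → X →L[ℂ] X} (hG : StrongContOn G) (hGP : ∀ t ∈ I, ∀ y, P t (G t y) = G t y)
    {η : ENNReal} (hη : 0 < η) :
    ∃ δ ∈ Ioc 0 δ₀, ∫⁻ t in I, ‖G t ∘L ((δ * e t : ℂ) • R δ t)‖ₑ ≤ η := by
  obtain ⟨C, hC0, hC⟩ := hG.exists_bound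
  have key := tendsto_lintegral_enorm (C := C * M₀)
    (T := fun n t => G t ∘L (((δ₀ * (1 / ((n : ℝ) + 1)) : ℝ) * e t : ℂ)
      • R (δ₀ * (1 / ((n : ℝ) + 1))) t))
    (fun n => hG.comp (h.strongContOn_smul_reduced (h.seq_mem n))) (fun n t ht => ?_) ?_
  · obtain ⟨n, hn⟩ := (ENNReal.tendsto_nhds_zero.1 key η hη).exists
    exact ⟨_, h.seq_mem n, hn⟩
  · refine (ContinuousLinearMap.opNorm_comp_le _ _).trans ?_
    exact mul_le_mul (hC t ht) (h.norm_smul_reduced (h.seq_mem n) ht) (norm_nonneg _) hC0.le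
  · filter_upwards [h.assoc, ae_restrict_mem measurableSet_Icc] with t hat ht
    have hfr : FiniteRank (G t) :=
      (h.finiteRank t ht).of_range_le 1 fun y => ⟨G t y, (hGP t ht y).symm⟩
    refine hfr.tendsto_comp_norm fun ψ => ?_
    have := (hat.tendsto_comp_smul_reducedResolvent hX (fun n => (h.seq_mem n).1) (seq_tendsto δ₀)
      (h.norm_dir t) (fun n => h.reduced _ (h.seq_mem n) t ht)
      (fun n => h.norm_reduced _ (h.seq_mem n) t ht) ψ).const_smul (e t)
    rw [(by ext; simp : e t • (0 : X →L[ℂ] ℂ) = 0)] at this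
    refine this.congr fun n => ?_
    rw [← ContinuousLinearMap.comp_smul, smul_smul, mul_comm]

end SpectralData

/-! ### Approximate solutions of the commutator equation -/

/-- `B` solves the commutator equation `A B - B A = E` on vectors of `V t ⊂ D(A t)`. -/
def SolvesCommutator (A : ℝ → X →ₗ.[ℂ] X) (V : ℝ → Set X) (B E : ℝ → X →L[ℂ] X) : Prop :=
  ∀ t ∈ I, ∀ y : (A t).domain, (y : X) ∈ V t → ∃ hd : B t y ∈ (A t).domain,
    A t ⟨B t y, hd⟩ = B t (A t y) + E t y

theorem SolvesCommutator.add {A : ℝ → X →ₗ.[ℂ] X} {V : ℝ → Set X} {B E B' E' : ℝ → X →L[ℂ] X}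
    (h : SolvesCommutator A V B E) (h' : SolvesCommutator A V B' E') :
    SolvesCommutator A V (fun t => B t + B' t) (fun t => E t + E' t) := by
  intro t ht y hy
  obtain ⟨h1, h2⟩ := h t ht y hy
  obtain ⟨h3, h4⟩ := h' t ht y hy
  refine ⟨(A t).domain.add_mem h1 h3, ?_⟩
  have := LinearPMap.map_add (A t) ⟨_, h1⟩ ⟨_, h3⟩
  simp only [AddMemClass.mk_add_mk] at this
  simp only [add_apply]
  rw [this, h2, h4]
  abel

namespace SpectralData

variable {A : ℝ → X →ₗ.[ℂ] X} {l e : ℝ → ℂ} {P S : ℝ → X →L[ℂ] X} {R : ℝ → ℝ → X →L[ℂ] X}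
  {m : ℕ} {δ₀ M₀ : ℝ}

/-- Approximate solution of the commutator equation on the ranges of the projections, for
right-hand sides `G = (1 - P) G P`. Each induction step passes from `G` to `R G S`, which is
annihilated by a lower power of `S`. -/
theorem exists_solvesCommutator_of_pow [CompleteSpace X] (h : SpectralData A l e P S R m δ₀ M₀)
    (k : ℕ) {G : ℝ → X →L[ℂ] X} (hG : StrongC1 G)
    (hGP : ∀ t ∈ I, ∀ y, G t (P t y) = G t y) (hPG : ∀ t ∈ I, ∀ y, P t (G t y) = 0)
    (hk : ∀ t ∈ I, G t ∘L S t ^ k = 0) {η : ENNReal} (hη : 0 < η) :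
    ∃ B E : ℝ → X →L[ℂ] X, StrongC1 B ∧ StrongContOn E ∧
      SolvesCommutator A (fun t => {y | P t y = y}) B E ∧
      ∫⁻ t in I, ‖G t - E t‖ₑ ≤ η := by
  induction k generalizing G η with
  | zero =>
    have hG0 : ∀ t ∈ I, G t = 0 := fun t ht => by
      have := hk t ht
      ext y
      simpa using DFunLike.congr_fun this y
    refine ⟨fun _ => 0, fun _ => 0, .const 0, .const 0, fun t ht y _ =>
      ⟨(A t).domain.zero_mem, ?_⟩, ?_⟩
    · simp only [zero_apply, add_zero]
      exact LinearPMap.map_zero (A t)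
    · rw [setLIntegral_congr_fun (g := fun _ => 0) measurableSet_Icc fun t ht => by
        simp only [hG0 t ht, sub_zero, enorm_clm_zero]]
      simp
  | succ k ih =>
    have hη2 : 0 < η / 2 := ENNReal.half_pos hη.ne'
    obtain ⟨δ, hδ, hδη⟩ := h.exists_lintegral_comp_le hG.strongContOn hGP hη2
    have hRC := h.contDiff_reduced δ hδ
    obtain ⟨B, E, hB, hE, hBE, hEη⟩ := ih (G := fun t => R δ t ∘L G t ∘L S t)
      (hRC.comp (hG.comp h.contDiff_nil))
      (fun t ht y => by simp [(h.nilpotent t ht).nil_proj])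
      (fun t ht y => (h.reduced δ hδ t ht).proj_res _)
      (fun t ht => by
        have h1 := hk t ht
        rw [pow_succ'] at h1
        ext y
        have h2 := congrArg (R δ t) (DFunLike.congr_fun h1 y)
        simpa using h2) hη2
    -- the leading term `-R G` solves the equation up to `G S`-terms and a term with a factor `δ`
    have hlead : SolvesCommutator A (fun t => {y | P t y = y}) (fun t => - (R δ t ∘L G t))
        (fun t => G t - ((δ * e t : ℂ) • R δ t) ∘L G t - R δ t ∘L G t ∘L S t) := by
      intro t ht y hy
      have hn := h.nilpotent t ht
      obtain ⟨h1, h2⟩ := (h.reduced δ hδ t ht).apply_res (G t y)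
      refine ⟨(A t).domain.neg_mem h1, ?_⟩
      have h3 := LinearPMap.map_neg (A t) ⟨_, h1⟩
      have h4 : G t (A t y) = l t • G t y - G t (S t y) := by
        rw [← hGP t ht, hn.proj_apply, map_sub, map_smul, hGP t ht]
      have h5 : A t ⟨(-(R δ t ∘L G t)) y, (A t).domain.neg_mem h1⟩
          = - A t ⟨R δ t (G t y), h1⟩ := h3
      rw [h5, h2, hPG t ht]
      simp only [neg_apply, ContinuousLinearMap.comp_apply, sub_apply, smul_apply, h4, map_sub,
        map_smul]
      module
    refine ⟨_, _, (hRC.comp hG).neg.add hB, StrongContOn.add ?_ hE, hlead.add hBE, ?_⟩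
    · exact (hG.strongContOn.sub ((h.strongContOn_smul_reduced hδ).comp hG.strongContOn)).sub
        (hRC.comp (hG.comp h.contDiff_nil)).strongContOn
    · calc _ ≤ ∫⁻ t in I, (‖((δ * e t : ℂ) • R δ t) ∘L G t‖ₑ
            + ‖R δ t ∘L G t ∘L S t - E t‖ₑ) := by
            refine lintegral_mono fun t => ?_
            refine le_trans (le_of_eq ?_) (enorm_clm_add_le _ _)
            congr 1
            abel
        _ = _ := lintegral_add_left'
            ((h.strongContOn_smul_reduced hδ).comp hG.strongContOn).aemeasurable_enorm _
        _ ≤ η / 2 + η / 2 := add_le_add hδη hEη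
        _ = η := ENNReal.add_halves η

/-- Approximate solution of the commutator equation on the kernels of the projections, for
right-hand sides `G = P G`. Each induction step passes from `G` to `S G R`. -/
theorem exists_solvesCommutator_of_pow' [CompleteSpace X] (hX : Reflexive X)
    (h : SpectralData A l e P S R m δ₀ M₀)
    (k : ℕ) {G : ℝ → X →L[ℂ] X} (hG : StrongC1 G)
    (hPG : ∀ t ∈ I, ∀ y, P t (G t y) = G t y)
    (hk : ∀ t ∈ I, (S t ^ k) ∘L G t = 0) {η : ENNReal} (hη : 0 < η) :
    ∃ B E : ℝ → X →L[ℂ] X, StrongC1 B ∧ StrongContOn E ∧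
      SolvesCommutator A (fun t => {y | P t y = 0}) B E ∧
      ∫⁻ t in I, ‖G t - E t‖ₑ ≤ η := by
  induction k generalizing G η with
  | zero =>
    have hG0 : ∀ t ∈ I, G t = 0 := fun t ht => by
      have := hk t ht
      ext y
      simpa using DFunLike.congr_fun this y
    refine ⟨fun _ => 0, fun _ => 0, .const 0, .const 0, fun t ht y _ =>
      ⟨(A t).domain.zero_mem, ?_⟩, ?_⟩
    · simp only [zero_apply, add_zero]
      exact LinearPMap.map_zero (A t)
    · rw [setLIntegral_congr_fun (g := fun _ => 0) measurableSet_Icc fun t ht => by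
        simp only [hG0 t ht, sub_zero, enorm_clm_zero]]
      simp
  | succ k ih =>
    have hη2 : 0 < η / 2 := ENNReal.half_pos hη.ne'
    obtain ⟨δ, hδ, hδη⟩ := h.exists_lintegral_comp_le' hX hG.strongContOn hPG hη2
    have hRC := h.contDiff_reduced δ hδ
    obtain ⟨B, E, hB, hE, hBE, hEη⟩ := ih (G := fun t => S t ∘L G t ∘L R δ t)
      (h.contDiff_nil.comp (hG.comp hRC))
      (fun t ht y => (h.nilpotent t ht).proj_nil _)
      (fun t ht => by
        have h1 := hk t ht
        rw [pow_succ] at h1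
        ext y
        have h2 := DFunLike.congr_fun h1 (R δ t y)
        simpa using h2) hη2
    -- the leading term `G R` leaves the `S G`-terms and a term with a factor `δ`
    have hlead : SolvesCommutator A (fun t => {y | P t y = 0}) (fun t => G t ∘L R δ t)
        (fun t => G t - G t ∘L ((δ * e t : ℂ) • R δ t) - S t ∘L G t ∘L R δ t) := by
      intro t ht y hy
      have hy' : P t y = 0 := hy
      have hn := h.nilpotent t ht
      obtain ⟨h1, h2⟩ := hn.apply_proj (G t (R δ t y))
      simp only [hPG t ht] at h1 h2
      refine ⟨h1, ?_⟩
      have h3 : A t ⟨(G t ∘L R δ t) y, h1⟩ = _ := h2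
      rw [h3]
      simp only [ContinuousLinearMap.comp_apply, sub_apply, smul_apply,
        (h.reduced δ hδ t ht).res_apply y, hy', map_sub, map_smul, map_zero]
      module
    refine ⟨_, _, (hG.comp hRC).add hB, StrongContOn.add ?_ hE, hlead.add hBE, ?_⟩
    · exact (hG.strongContOn.sub (hG.strongContOn.comp (h.strongContOn_smul_reduced hδ))).sub
        (h.contDiff_nil.comp (hG.comp hRC)).strongContOn
    · calc _ ≤ ∫⁻ t in I, (‖G t ∘L ((δ * e t : ℂ) • R δ t)‖ₑ
            + ‖S t ∘L G t ∘L R δ t - E t‖ₑ) := by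
            refine lintegral_mono fun t => ?_
            refine le_trans (le_of_eq ?_) (enorm_clm_add_le _ _)
            congr 1
            abel
        _ = _ := lintegral_add_left'
            (hG.strongContOn.comp (h.strongContOn_smul_reduced hδ)).aemeasurable_enorm _
        _ ≤ η / 2 + η / 2 := add_le_add hδη hEη
        _ = η := ENNReal.add_halves η

end SpectralData

namespace SpectralData

variable {A : ℝ → X →ₗ.[ℂ] X} {l e : ℝ → ℂ} {P S : ℝ → X →L[ℂ] X} {R : ℝ → ℝ → X →L[ℂ] X}
  {m : ℕ} {δ₀ M₀ : ℝ}

theorem idem (h : SpectralData A l e P S R m δ₀ M₀) {t : ℝ} (ht : t ∈ I) (y : X) :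
    P t (P t y) = P t y :=
  (h.nilpotent t ht).idem y

theorem lintegral_sub_le {F G E : ℝ → X →L[ℂ] X} (hF : StrongContOn F) (hG : StrongContOn G)
    {η : ENNReal} (h1 : ∫⁻ t in I, ‖F t - G t‖ₑ ≤ η / 2)
    (h2 : ∫⁻ t in I, ‖G t - E t‖ₑ ≤ η / 2) : ∫⁻ t in I, ‖F t - E t‖ₑ ≤ η := by
  calc _ ≤ ∫⁻ t in I, (‖F t - G t‖ₑ + ‖G t - E t‖ₑ) := by
        refine lintegral_mono fun t => le_trans (le_of_eq ?_) (enorm_clm_add_le _ _)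
        rw [sub_add_sub_cancel]
    _ = _ := lintegral_add_left' (hF.sub hG).aemeasurable_enorm _
    _ ≤ η / 2 + η / 2 := add_le_add h1 h2
    _ = η := ENNReal.add_halves η

/-- The commutator equation for `(1 - P) P' P` can be solved up to an arbitrarily small error on
the ranges of the projections. -/
theorem exists_solvesCommutator [CompleteSpace X] (h : SpectralData A l e P S R m δ₀ M₀)
    {η : ENNReal} (hη : 0 < η) :
    ∃ B E : ℝ → X →L[ℂ] X, StrongC1 B ∧ StrongContOn E ∧
      SolvesCommutator A (fun t => {y | P t y = y}) B E ∧
      ∫⁻ t in I, ‖(1 - P t) ∘L strongDeriv P t ∘L P t - E t‖ₑ ≤ η := by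
  have hP := h.contDiff_proj
  have hη2 : 0 < η / 2 := ENNReal.half_pos hη.ne'
  have hQ1 : StrongC1 fun t => 1 - P t := (StrongC1.const 1).sub hP
  obtain ⟨C, hC0, hC, hCl⟩ := hP.norm_sub_le
  obtain ⟨C₁, hC₁0, hC₁⟩ := hQ1.strongContOn.exists_bound
  obtain ⟨C₂, hC₂0, hC₂⟩ := hP.strongContOn.exists_bound
  let G : ℕ → ℝ → X →L[ℂ] X := fun n t => (1 - P t) ∘L diffQuot P (1 / ((n : ℝ) + 1)) t ∘L P t
  have hG : ∀ n, StrongC1 (G n) := fun n =>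
    hQ1.comp ((hP.diffQuot (one_div_add_one_mem n)).comp hP)
  have hF : StrongContOn fun t => (1 - P t) ∘L strongDeriv P t ∘L P t :=
    hQ1.strongContOn.comp (hP.strongContOn_strongDeriv.comp hP.strongContOn)
  have key := tendsto_lintegral_enorm (C := C₁ * ((C + C) * C₂))
    (T := fun n t => (1 - P t) ∘L strongDeriv P t ∘L P t - G n t)
    (fun n => hF.sub (hG n).strongContOn) (fun n t ht => ?_) ?_
  · obtain ⟨n, hn⟩ := (ENNReal.tendsto_nhds_zero.1 key _ hη2).exists
    obtain ⟨B, E, hB, hE, hBE, hEη⟩ := h.exists_solvesCommutator_of_pow m (hG n)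
      (fun t ht y => by simp [G, h.idem ht]) (fun t ht y => by simp [G, h.idem ht])
      (fun t ht => by simp [(h.nilpotent t ht).pow_eq_zero]) hη2
    exact ⟨B, E, hB, hE, hBE, lintegral_sub_le hF (hG n).strongContOn hn hEη⟩
  · have h1 : (1 - P t) ∘L strongDeriv P t ∘L P t - G n t
        = (1 - P t) ∘L ((strongDeriv P t - diffQuot P (1 / ((n : ℝ) + 1)) t) ∘L P t) := by
      ext y; simp [G]
    rw [h1]
    have h2 := norm_diffQuot_le hCl (one_div_add_one_mem n) ht
    have h3 := (norm_sub_le (strongDeriv P t) (diffQuot P (1 / ((n : ℝ) + 1)) t)).trans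
      (add_le_add (hC t ht) h2)
    refine (ContinuousLinearMap.opNorm_comp_le _ _).trans ?_
    refine mul_le_mul (hC₁ t ht) ?_ (norm_nonneg _) hC₁0.le
    refine (ContinuousLinearMap.opNorm_comp_le _ _).trans ?_
    exact mul_le_mul h3 (hC₂ t ht) (norm_nonneg _) (by positivity)
  · filter_upwards [ae_restrict_mem measurableSet_Icc] with t ht
    have h1 : ∀ n, (1 - P t) ∘L strongDeriv P t ∘L P t - G n t
        = ((1 - P t) ∘L (strongDeriv P t - diffQuot P (1 / ((n : ℝ) + 1)) t)) ∘L P t := fun n => by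
      ext y; simp [G]
    simp only [h1]
    refine (h.finiteRank t ht).tendsto_norm_comp fun x => ?_
    have h2 := (tendsto_diffQuot ht (hP.hasDerivWithinAt ht x)).comp
      tendsto_one_div_add_one_nhdsWithin
    have h3 := ((1 - P t).continuous.tendsto _).comp (h2.const_sub (strongDeriv P t x))
    rw [sub_self, map_zero] at h3
    exact h3

/-- In reflexive spaces, and for projections which are continuously differentiable in norm, the
commutator equation for `-P P' (1 - P)` can be solved up to an arbitrarily small error on the
kernels of the projections. -/
theorem exists_solvesCommutator' [CompleteSpace X] (hX : Reflexive X)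
    (h : SpectralData A l e P S R m δ₀ M₀) (hPn : ContDiffOn ℝ 1 P I)
    {η : ENNReal} (hη : 0 < η) :
    ∃ B E : ℝ → X →L[ℂ] X, StrongC1 B ∧ StrongContOn E ∧
      SolvesCommutator A (fun t => {y | P t y = 0}) B E ∧
      ∫⁻ t in I, ‖-(P t ∘L strongDeriv P t ∘L (1 - P t)) - E t‖ₑ ≤ η := by
  have hP := h.contDiff_proj
  have hη2 : 0 < η / 2 := ENNReal.half_pos hη.ne'
  have hQ1 : StrongC1 fun t => 1 - P t := (StrongC1.const 1).sub hP
  obtain ⟨C, hC0, hC, hCl⟩ := hP.norm_sub_le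
  obtain ⟨C₁, hC₁0, hC₁⟩ := hQ1.strongContOn.exists_bound
  obtain ⟨C₂, hC₂0, hC₂⟩ := hP.strongContOn.exists_bound
  let G : ℕ → ℝ → X →L[ℂ] X := fun n t =>
    -(P t ∘L diffQuot P (1 / ((n : ℝ) + 1)) t ∘L (1 - P t))
  have hG : ∀ n, StrongC1 (G n) := fun n =>
    (hP.comp ((hP.diffQuot (one_div_add_one_mem n)).comp hQ1)).neg
  have hF : StrongContOn fun t => -(P t ∘L strongDeriv P t ∘L (1 - P t)) :=
    (hP.strongContOn.comp (hP.strongContOn_strongDeriv.comp hQ1.strongContOn)).neg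
  have hbound : ∀ n, ∀ t ∈ I, ‖-(P t ∘L strongDeriv P t ∘L (1 - P t)) - G n t‖
      ≤ C₂ * (‖diffQuot P (1 / ((n : ℝ) + 1)) t - strongDeriv P t‖ * C₁) := fun n t ht => by
    have h1 : -(P t ∘L strongDeriv P t ∘L (1 - P t)) - G n t
        = P t ∘L ((diffQuot P (1 / ((n : ℝ) + 1)) t - strongDeriv P t) ∘L (1 - P t)) := by
      ext y; simp [G]; abel
    rw [h1]
    refine (ContinuousLinearMap.opNorm_comp_le _ _).trans ?_
    refine mul_le_mul (hC₂ t ht) ?_ (norm_nonneg _) hC₂0.le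
    refine (ContinuousLinearMap.opNorm_comp_le _ _).trans ?_
    gcongr
    exact hC₁ t ht
  have key := tendsto_lintegral_enorm (C := C₂ * ((C + C) * C₁))
    (T := fun n t => -(P t ∘L strongDeriv P t ∘L (1 - P t)) - G n t)
    (fun n => hF.sub (hG n).strongContOn) (fun n t ht => ?_) ?_
  · obtain ⟨n, hn⟩ := (ENNReal.tendsto_nhds_zero.1 key _ hη2).exists
    obtain ⟨B, E, hB, hE, hBE, hEη⟩ := h.exists_solvesCommutator_of_pow' hX m (hG n)
      (fun t ht y => by simp [G, h.idem ht])
      (fun t ht => by simp [(h.nilpotent t ht).pow_eq_zero]) hη2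
    exact ⟨B, E, hB, hE, hBE, lintegral_sub_le hF (hG n).strongContOn hn hEη⟩
  · refine (hbound n t ht).trans ?_
    have h2 := norm_diffQuot_le hCl (one_div_add_one_mem n) ht
    have h3 := (norm_sub_le (diffQuot P (1 / ((n : ℝ) + 1)) t) (strongDeriv P t)).trans
      (add_le_add h2 (hC t ht))
    gcongr
  · filter_upwards [ae_restrict_mem measurableSet_Icc] with t ht
    have hd := (hPn.differentiableOn one_ne_zero t ht).hasDerivWithinAt
    have hd' : derivWithin P I t = strongDeriv P t := by
      ext x
      refine (hP.strongDeriv_apply_eq ht ?_).symm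
      exact (((ContinuousLinearMap.apply ℂ X x).restrictScalars ℝ).hasFDerivAt
        (x := P t)).comp_hasDerivWithinAt t hd
    rw [hd'] at hd
    have h2 := tendsto_iff_norm_sub_tendsto_zero.1
      ((tendsto_diffQuot ht hd).comp tendsto_one_div_add_one_nhdsWithin)
    have h3 := (h2.mul_const C₁).const_mul C₂
    rw [zero_mul, mul_zero] at h3
    exact squeeze_zero (fun _ => norm_nonneg _) (fun n => hbound n t ht) h3

end SpectralData

/-! ### Comparison of evolutions -/

/-- `v` solves `v' = (1/ε) A v + K v` on `I`. -/
def IsTrajectory (A : ℝ → X →ₗ.[ℂ] X) (K : ℝ → X →L[ℂ] X) (ε : ℝ) (v : ℝ → X) : Prop :=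
  ∀ τ ∈ I, ∃ hd : v τ ∈ (A τ).domain,
    HasDerivWithinAt v ((1 / (ε : ℂ)) • A τ ⟨v τ, hd⟩ + K τ (v τ)) I τ

theorem IsTrajectory.continuousOn {A : ℝ → X →ₗ.[ℂ] X} {K : ℝ → X →L[ℂ] X} {ε : ℝ} {v : ℝ → X}
    (hv : IsTrajectory A K ε v) : ContinuousOn v I :=
  fun τ hτ => (hv τ hτ).choose_spec.continuousWithinAt

/-- Integral form of Grönwall's inequality. -/
theorem norm_le_of_norm_le_integral {Y : Type*} [NormedAddCommGroup Y] {v : ℝ → Y}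
    (hv : ContinuousOn v I) {a b : ℝ} (hb : 0 < b)
    (h : ∀ t ∈ I, ‖v t‖ ≤ a + b * ∫ τ in (0 : ℝ)..t, ‖v τ‖) :
    ∀ t ∈ I, ‖v t‖ ≤ a * Real.exp b := by
  have ha : 0 ≤ a := by
    have := h 0 ⟨le_rfl, zero_le_one⟩
    rw [intervalIntegral.integral_same, mul_zero, add_zero] at this
    exact (norm_nonneg _).trans this
  let w : ℝ → ℝ := IccExtend zero_le_one (I.domRestrict fun t => ‖v t‖)
  have hw : Continuous w := hv.norm.domRestrict.Icc_extend'
  have hwv : ∀ t ∈ I, w t = ‖v t‖ := fun t ht => IccExtend_of_mem _ _ ht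
  have hint : ∀ t ∈ I, ∫ τ in (0 : ℝ)..t, ‖v τ‖ = ∫ τ in (0 : ℝ)..t, w τ := fun t ht => by
    refine intervalIntegral.integral_congr fun τ hτ => ?_
    rw [uIcc_of_le ht.1] at hτ
    exact (hwv τ ⟨hτ.1, hτ.2.trans ht.2⟩).symm
  have hd : ∀ t, HasDerivAt (fun t => ∫ τ in (0 : ℝ)..t, w τ) (w t) t := fun t =>
    (hw.integral_hasStrictDerivAt 0 t).hasDerivAt
  have hG := norm_le_gronwallBound_of_norm_deriv_right_le (δ := 0) (K := b) (ε := a) (a := 0)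
    (b := 1) (fun t _ => (hd t).continuousAt.continuousWithinAt)
    (fun t _ => (hd t).hasDerivWithinAt) (by simp) (fun t ht => ?_)
  · intro t ht
    refine (h t ht).trans ?_
    have h1 := hG t ht
    simp only [gronwallBound_of_K_ne_0 hb.ne', sub_zero, zero_mul, zero_add] at h1
    rw [hint t ht]
    have h2 := (le_abs_self _).trans h1
    have h3 : Real.exp (b * t) ≤ Real.exp b :=
      Real.exp_le_exp.2 (mul_le_of_le_one_right hb.le ht.2)
    calc a + b * ∫ τ in (0 : ℝ)..t, w τ ≤ a + b * (a / b * (Real.exp (b * t) - 1)) := by gcongr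
      _ = a * Real.exp (b * t) := by field_simp; ring
      _ ≤ a * Real.exp b := by gcongr
  · have htI : t ∈ I := ⟨ht.1, ht.2.le⟩
    rw [hwv t htI, norm_norm]
    have h1 := h t htI
    rw [hint t htI] at h1
    have h2 := mul_le_mul_of_nonneg_left (le_abs_self (∫ τ in (0 : ℝ)..t, w τ)) hb.le
    rw [Real.norm_eq_abs]
    linarith

section Comparison

variable {A : ℝ → X →ₗ.[ℂ] X} {U : ℝ → ℝ → X →L[ℂ] X} {K : ℝ → X →L[ℂ] X} {ε M : ℝ}

theorem IsTrajectory.sub_eq_integral [CompleteSpace X]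
    (hA : ∀ t ∈ I, Dense ((A t).domain : Set X))
    (hU : IsEvolutionSystem (fun t => (1 / (ε : ℂ)) • A t) U) (hK : StrongContOn K) {v : ℝ → X}
    (hv : IsTrajectory A K ε v) {t : ℝ} (ht : t ∈ I) :
    v t - U t 0 (v 0) = ∫ τ in (0 : ℝ)..t, U t τ (K τ (v τ)) :=
  hU.duhamel hA (hK.apply hv.continuousOn) hv ht

theorem IsTrajectory.norm_le [CompleteSpace X] (hA : ∀ t ∈ I, Dense ((A t).domain : Set X))
    (hU : IsEvolutionSystem (fun t => (1 / (ε : ℂ)) • A t) U) (hM : 0 < M)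
    (hUM : ∀ s t : ℝ, (s, t) ∈ Triangle → ‖U t s‖ ≤ M) (hK : StrongContOn K) {κ : ℝ} (hκ : 0 < κ)
    (hKκ : ∀ t ∈ I, ‖K t‖ ≤ κ) {v : ℝ → X} (hv : IsTrajectory A K ε v) :
    ∀ t ∈ I, ‖v t‖ ≤ M * Real.exp (M * κ) * ‖v 0‖ := by
  have hvc := hv.continuousOn
  have h0 : (0 : ℝ) ∈ I := ⟨le_rfl, zero_le_one⟩
  intro t ht
  rw [mul_right_comm]
  revert t
  refine norm_le_of_norm_le_integral hvc (by positivity) fun t ht => ?_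
  have h1 := hv.sub_eq_integral hA hU hK ht
  rw [sub_eq_iff_eq_add'] at h1
  rw [h1]
  have hsub : Icc 0 t ⊆ I := Icc_subset_Icc_right ht.2
  refine (norm_add_le _ _).trans (add_le_add
    ((U t 0).le_of_opNorm_le (hUM _ _ ⟨h0, ht, ht.1⟩) _) ?_)
  rw [← intervalIntegral.integral_const_mul]
  refine intervalIntegral.norm_integral_le_of_norm_le ht.1 (Eventually.of_forall fun τ hτ => ?_) ?_
  · have hτI : τ ∈ I := hsub ⟨hτ.1.le, hτ.2⟩
    refine ((U t τ).le_of_opNorm_le (hUM _ _ ⟨hτI, ht, hτ.2⟩) _).trans ?_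
    rw [mul_assoc]
    gcongr
    exact (K τ).le_of_opNorm_le (hKκ τ hτI) _
  · refine ContinuousOn.intervalIntegrable ?_
    rw [uIcc_of_le ht.1]
    exact continuousOn_const.mul (hvc.mono hsub).norm

/-- Integration by parts: against trajectories, a solution `B` of the commutator equation with
right-hand side `E` turns the integral of `U E v` into a term with a factor `ε`. -/
theorem IsTrajectory.integral_eq [CompleteSpace X] (hA : ∀ t ∈ I, Dense ((A t).domain : Set X))
    (hε : 0 < ε) (hU : IsEvolutionSystem (fun t => (1 / (ε : ℂ)) • A t) U)
    (hK : StrongContOn K) {V : ℝ → Set X} {B E : ℝ → X →L[ℂ] X} (hB : StrongC1 B)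
    (hE : StrongContOn E) (hBE : SolvesCommutator A V B E) {v : ℝ → X}
    (hv : IsTrajectory A K ε v) (hvV : ∀ t ∈ I, v t ∈ V t) {t : ℝ} (ht : t ∈ I) :
    ∫ τ in (0 : ℝ)..t, U t τ (E τ (v τ)) = (ε : ℂ) •
      ((∫ τ in (0 : ℝ)..t, U t τ (strongDeriv B τ (v τ) + B τ (K τ (v τ))))
        - B t (v t) + U t 0 (B 0 (v 0))) := by
  have hvc := hv.continuousOn
  have hε' : (ε : ℂ) ≠ 0 := by exact_mod_cast hε.ne'
  have hg1 : ContinuousOn (fun τ => strongDeriv B τ (v τ) + B τ (K τ (v τ))) I :=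
    (hB.strongContOn_strongDeriv.apply hvc).add (hB.strongContOn.apply (hK.apply hvc))
  have hg2 : ContinuousOn (fun τ => (1 / (ε : ℂ)) • E τ (v τ)) I :=
    (hE.apply hvc).const_smul _
  have h := hU.duhamel hA (v := fun τ => B τ (v τ)) (hg1.sub hg2) (fun τ hτ => ?_) ht
  · have hsub : Icc 0 t ⊆ I := Icc_subset_Icc_right ht.2
    have hi : ∀ g : ℝ → X, ContinuousOn g I →
        IntervalIntegrable (fun τ => U t τ (g τ)) volume 0 t := fun g hg => by
      refine ContinuousOn.intervalIntegrable ?_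
      rw [uIcc_of_le ht.1]
      exact continuousOn_clm_apply isCompact_Icc (hU.continuousOn_snd ht) (hg.mono hsub)
    simp only [Pi.sub_apply, map_sub] at h
    rw [intervalIntegral.integral_sub (hi _ hg1) (hi _ hg2)] at h
    simp only [map_smul] at h
    rw [intervalIntegral.integral_smul] at h
    rw [← inv_smul_eq_iff₀ hε', ← one_div]
    rw [eq_sub_iff_add_eq, ← eq_sub_iff_add_eq'] at h
    rw [h]
    abel
  · obtain ⟨hd, hd'⟩ := hv τ hτ
    obtain ⟨h1, h2⟩ := hBE τ hτ ⟨v τ, hd⟩ (hvV τ hτ)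
    refine ⟨h1, (hB.hasDerivWithinAt_apply hτ hd').congr_deriv ?_⟩
    have h3 : ((1 / (ε : ℂ)) • A τ) ⟨B τ (v τ), h1⟩
        = (1 / (ε : ℂ)) • (B τ (A τ ⟨v τ, hd⟩) + E τ (v τ)) := congrArg _ h2
    rw [h3]
    simp only [Pi.sub_apply, map_add, map_smul, smul_add]
    abel

/-- If the perturbation `K`, restricted to the subspaces `V t`, is the right-hand side of an
approximately solvable commutator equation, then trajectories running in `V t` follow the
unperturbed evolution, uniformly, in the adiabatic limit. -/
theorem exists_norm_sub_le [CompleteSpace X] (hA : ∀ t ∈ I, Dense ((A t).domain : Set X))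
    {U : ℝ → ℝ → ℝ → X →L[ℂ] X}
    (hU : ∀ ε : ℝ, 0 < ε → IsEvolutionSystem (fun t => (1 / (ε : ℂ)) • A t) (U ε)) (hM : 0 < M)
    (hUM : ∀ ε : ℝ, 0 < ε → ∀ s t : ℝ, (s, t) ∈ Triangle → ‖U ε t s‖ ≤ M)
    (hK : StrongContOn K) {V : ℝ → Set X} {F : ℝ → X →L[ℂ] X}
    (hKF : ∀ t ∈ I, ∀ y ∈ V t, K t y = F t y)
    (hF : ∀ η : ENNReal, 0 < η → ∃ B E : ℝ → X →L[ℂ] X, StrongC1 B ∧ StrongContOn E ∧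
      SolvesCommutator A V B E ∧ ∫⁻ t in I, ‖F t - E t‖ₑ ≤ η)
    {η : ℝ} (hη : 0 < η) :
    ∃ ε₀ > 0, ∀ ε ∈ Ioo 0 ε₀, ∀ v, IsTrajectory A K ε v → (∀ t ∈ I, v t ∈ V t) →
      ∀ t ∈ I, ‖v t - U ε t 0 (v 0)‖ ≤ η * ‖v 0‖ := by
  have h0 : (0 : ℝ) ∈ I := ⟨le_rfl, zero_le_one⟩
  obtain ⟨κ, hκ, hKκ⟩ := hK.exists_bound
  set c : ℝ := M * Real.exp (M * κ) with hc
  have hc0 : 0 < c := by positivity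
  -- the error in the commutator equation enters the estimate with the factor `M * c`, where `c`
  -- bounds the growth of trajectories uniformly in `ε`
  set η₁ : ℝ := η / 2 / (M * c) with hη₁
  have hη₁0 : 0 < η₁ := by positivity
  obtain ⟨B, E, hB, hE, hBE, hEη⟩ := hF (ENNReal.ofReal η₁) (ENNReal.ofReal_pos.2 hη₁0)
  obtain ⟨β, hβ, hBβ⟩ := hB.strongContOn.exists_bound
  obtain ⟨β', hβ', hBβ'⟩ := hB.strongContOn_strongDeriv.exists_bound
  -- the remaining terms are bounded by `ε * D`
  set D : ℝ := M * ((β' + β * κ) * c) + β * c + M * β with hD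
  have hD0 : 0 < D := by positivity
  refine ⟨η / 2 / D, by positivity, fun ε hε v hv hvV t ht => ?_⟩
  have hvc := hv.continuousOn
  have hvb := hv.norm_le hA (hU ε hε.1) hM (hUM ε hε.1) hK hκ hKκ
  have hsub : Icc 0 t ⊆ I := Icc_subset_Icc_right ht.2
  have hi : ∀ g : ℝ → X, ContinuousOn g I →
      IntervalIntegrable (fun τ => U ε t τ (g τ)) volume 0 t := fun g hg => by
    refine ContinuousOn.intervalIntegrable ?_
    rw [uIcc_of_le ht.1]
    exact continuousOn_clm_apply isCompact_Icc ((hU ε hε.1).continuousOn_snd ht) (hg.mono hsub)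
  have hUb : ∀ τ ∈ Ioc 0 t, ∀ y, ‖U ε t τ y‖ ≤ M * ‖y‖ := fun τ hτ y =>
    (U ε t τ).le_of_opNorm_le (hUM ε hε.1 _ _ ⟨hsub ⟨hτ.1.le, hτ.2⟩, ht, hτ.2⟩) y
  have hsplit : v t - U ε t 0 (v 0)
      = (∫ τ in (0 : ℝ)..t, U ε t τ ((F τ - E τ) (v τ)))
        + ∫ τ in (0 : ℝ)..t, U ε t τ (E τ (v τ)) := by
    have hcongr : ∀ τ ∈ uIcc 0 t, (F τ - E τ) (v τ) = K τ (v τ) - E τ (v τ) := fun τ hτ => by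
      rw [uIcc_of_le ht.1] at hτ
      rw [sub_apply, hKF τ (hsub hτ) _ (hvV τ (hsub hτ))]
    have hdiff : ∫ τ in (0 : ℝ)..t, U ε t τ ((F τ - E τ) (v τ))
        = (∫ τ in (0 : ℝ)..t, U ε t τ (K τ (v τ))) - ∫ τ in (0 : ℝ)..t, U ε t τ (E τ (v τ)) := by
      rw [← intervalIntegral.integral_sub (hi _ (hK.apply hvc)) (hi _ (hE.apply hvc))]
      exact intervalIntegral.integral_congr fun τ hτ => by simp only [hcongr τ hτ, map_sub]
    rw [hv.sub_eq_integral hA (hU ε hε.1) hK ht, hdiff, sub_add_cancel]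
  have hfirst : ‖∫ τ in (0 : ℝ)..t, U ε t τ ((F τ - E τ) (v τ))‖ ≤ η / 2 * ‖v 0‖ := by
    have h1 : ‖∫ τ in (0 : ℝ)..t, U ε t τ ((F τ - E τ) (v τ))‖ₑ
        ≤ ENNReal.ofReal (M * c * ‖v 0‖) * ENNReal.ofReal η₁ := by
      rw [intervalIntegral.integral_of_le ht.1]
      refine (enorm_integral_le_lintegral_enorm _).trans ?_
      calc ∫⁻ τ in Ioc 0 t, ‖U ε t τ ((F τ - E τ) (v τ))‖ₑ
          ≤ ∫⁻ τ in Ioc 0 t, ENNReal.ofReal (M * c * ‖v 0‖) * ‖F τ - E τ‖ₑ := by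
            refine setLIntegral_mono' measurableSet_Ioc fun τ hτ => ?_
            rw [← ofReal_norm, ← ofReal_norm, ← ENNReal.ofReal_mul (by positivity)]
            refine ENNReal.ofReal_le_ofReal ((hUb τ hτ _).trans ?_)
            have h2 := (F τ - E τ).le_opNorm_of_le (hvb τ (hsub ⟨hτ.1.le, hτ.2⟩))
            calc M * ‖(F τ - E τ) (v τ)‖ ≤ M * (‖F τ - E τ‖ * (c * ‖v 0‖)) := by gcongr
              _ = M * c * ‖v 0‖ * ‖F τ - E τ‖ := by ring
        _ ≤ ∫⁻ τ in I, ENNReal.ofReal (M * c * ‖v 0‖) * ‖F τ - E τ‖ₑ :=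
            lintegral_mono_set (Ioc_subset_Icc_self.trans hsub)
        _ = ENNReal.ofReal (M * c * ‖v 0‖) * ∫⁻ τ in I, ‖F τ - E τ‖ₑ :=
            lintegral_const_mul' _ _ ENNReal.ofReal_ne_top
        _ ≤ _ := by gcongr
    rw [← ENNReal.ofReal_mul (by positivity), ← ofReal_norm,
      ENNReal.ofReal_le_ofReal_iff (by positivity)] at h1
    refine h1.trans_eq ?_
    rw [hη₁]
    field_simp
  have hsecond : ‖∫ τ in (0 : ℝ)..t, U ε t τ (E τ (v τ))‖ ≤ η / 2 * ‖v 0‖ := by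
    rw [hv.integral_eq hA hε.1 (hU ε hε.1) hK hB hE hBE hvV ht, norm_smul, Complex.norm_real,
      Real.norm_of_nonneg hε.1.le]
    have h1 : ‖∫ τ in (0 : ℝ)..t, U ε t τ (strongDeriv B τ (v τ) + B τ (K τ (v τ)))‖
        ≤ M * ((β' + β * κ) * c) * ‖v 0‖ := by
      have h2 := intervalIntegral.norm_integral_le_of_norm_le_const (a := 0) (b := t)
        (C := M * ((β' + β * κ) * c) * ‖v 0‖)
        (f := fun τ => U ε t τ (strongDeriv B τ (v τ) + B τ (K τ (v τ)))) fun τ hτ => by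
          rw [uIoc_of_le ht.1] at hτ
          have hτI : τ ∈ I := hsub ⟨hτ.1.le, hτ.2⟩
          refine (hUb τ hτ _).trans ?_
          rw [mul_assoc]
          refine mul_le_mul_of_nonneg_left ?_ hM.le
          refine (norm_add_le _ _).trans ?_
          have h3 := ((strongDeriv B τ).le_of_opNorm_le (hBβ' τ hτI) (v τ))
          have h4 := ((B τ).le_of_opNorm_le (hBβ τ hτI) (K τ (v τ)))
          have h5 := ((K τ).le_of_opNorm_le (hKκ τ hτI) (v τ))
          have h6 := hvb τ hτI
          calc _ ≤ β' * ‖v τ‖ + β * (κ * ‖v τ‖) := by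
                refine add_le_add h3 (h4.trans ?_); gcongr
            _ = (β' + β * κ) * ‖v τ‖ := by ring
            _ ≤ (β' + β * κ) * (c * ‖v 0‖) := by gcongr
            _ = _ := by ring
      refine h2.trans (mul_le_of_le_one_right (by positivity) ?_)
      rw [sub_zero, abs_of_nonneg ht.1]
      exact ht.2
    have h2 : ‖B t (v t)‖ ≤ β * c * ‖v 0‖ := by
      refine ((B t).le_of_opNorm_le (hBβ t ht) _).trans ?_
      rw [mul_assoc]
      gcongr
      exact hvb t ht
    have h3 : ‖U ε t 0 (B 0 (v 0))‖ ≤ M * β * ‖v 0‖ := by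
      refine ((U ε t 0).le_of_opNorm_le (hUM ε hε.1 _ _ ⟨h0, ht, ht.1⟩) _).trans ?_
      rw [mul_assoc]
      gcongr
      exact (B 0).le_of_opNorm_le (hBβ 0 h0) _
    have h4 : ε * D ≤ η / 2 := by
      have := hε.2.le
      rwa [le_div_iff₀ hD0] at this
    calc _ ≤ ε * (D * ‖v 0‖) := by
          refine mul_le_mul_of_nonneg_left ?_ hε.1.le
          refine (norm_add_le _ _).trans ((add_le_add (norm_sub_le _ _) le_rfl).trans ?_)
          rw [hD, add_mul, add_mul]
          exact add_le_add (add_le_add h1 h2) h3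
      _ = ε * D * ‖v 0‖ := by ring
      _ ≤ η / 2 * ‖v 0‖ := by gcongr
  rw [hsplit]
  calc _ ≤ η / 2 * ‖v 0‖ + η / 2 * ‖v 0‖ := (norm_add_le _ _).trans (add_le_add hfirst hsecond)
    _ = η * ‖v 0‖ := by ring

end Comparison

/-! ### The adiabatic theorem -/

/-- The hypotheses of the adiabatic theorem provide spectral data. -/
theorem exists_spectralData [CompleteSpace X] {A : ℝ → X →ₗ.[ℂ] X} {l : ℝ → ℂ} {δ₀ : ℝ}
    (hδ₀ : 0 < δ₀) {θ : ℝ → ℝ}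
    (hρ : ∀ δ ∈ Ioc 0 δ₀, ∀ t ∈ I,
      l t + δ * Complex.exp (Complex.I * θ t) ∈ resolventSetOf (A t))
    (hθC1 : ContDiffOn ℝ 1 (fun t => Complex.exp (Complex.I * θ t)) I)
    (hRC1 : ∀ δ ∈ Ioc 0 δ₀, StrongC1
      (fun t => resolventOp (A t) (l t + δ * Complex.exp (Complex.I * θ t))))
    {P : ℝ → X →L[ℂ] X} (hPidem : ∀ t ∈ I, P t ∘L P t = P t)
    (hPassoc : ∀ᵐ t ∂(volume.restrict I), WeaklyAssociated (A t) (l t) (P t))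
    {m₀ : ℕ} (hm₀ : 1 ≤ m₀) (hPcomm : ∀ t ∈ I, CommutesWith (P t) (A t))
    (hPker : ∀ t ∈ I, ∀ x : X, P t x ∈ kerPow (A t) (l t) m₀)
    (hPrank : FiniteRank (P 0)) (hPC1 : StrongC1 P) {M₀ : ℝ}
    (hR : ∀ δ ∈ Ioc 0 δ₀, ∀ t ∈ I,
      ‖resolventOp (A t) (l t + δ * Complex.exp (Complex.I * θ t)) ∘L (1 - P t)‖ ≤ M₀ / δ) :
    ∃ S : ℝ → X →L[ℂ] X, SpectralData A l (fun t => Complex.exp (Complex.I * θ t)) P S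
      (fun δ t => resolventOp (A t) (l t + δ * Complex.exp (Complex.I * θ t)) ∘L (1 - P t))
      m₀ δ₀ M₀ := by
  obtain ⟨c, δ, hδ, hS⟩ := exists_resolvent_combination (X := X) hm₀ hδ₀
  have hid : ∀ t ∈ I, ∀ y, P t (P t y) = P t y := fun t ht y => DFunLike.congr_fun (hPidem t ht) y
  have hres := fun δ hδ t ht => isResolventAt_resolventOp (hρ δ hδ t ht)
  refine ⟨fun t => Complex.exp (Complex.I * θ t) ^ 2 • ∑ j, c j •
    (resolventOp (A t) (l t + δ j * Complex.exp (Complex.I * θ t)) ∘L P t), ?_⟩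
  refine ⟨hδ₀, fun t => Complex.norm_exp_I_mul_ofReal _, hθC1.continuousOn, hPassoc,
    fun t ht => ?_, fun δ hδ t ht => ?_, hR, fun t ht => hPC1.finiteRank hid hPrank ht, hPC1, ?_,
    fun δ hδ => (hRC1 δ hδ).comp ((StrongC1.const 1).sub hPC1)⟩
  · refine (hPcomm t ht).isNilpotentPart hm₀ (hid t ht) (hPker t ht) fun y hd => ?_
    have := hS (A t) (l t) (Complex.exp (Complex.I * θ t))
      (fun δ => resolventOp (A t) (l t + δ * Complex.exp (Complex.I * θ t)))
      (Complex.exp_ne_zero _) (fun j => hres _ (hδ j) t ht) (P t y) (hPker t ht y) hd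
    rw [← this]
    simp [sum_apply]
  · exact (hres δ hδ t ht).isReducedResolvent (hPcomm t ht) (hid t ht)
  · exact .smul (hθC1.pow 2) (.sum fun j _ => .smul contDiffOn_const ((hRC1 _ (hδ j)).comp hPC1))

/-- The commutator `K = [P', P]` satisfies `K P - P K = P'`. -/
theorem comm_strongDeriv_apply_proj [CompleteSpace X] {P : ℝ → X →L[ℂ] X} (hP : StrongC1 P)
    (hid : ∀ t ∈ I, P t ∘L P t = P t) {t : ℝ} (ht : t ∈ I) (y : X) :
    comm (strongDeriv P t) (P t) (P t y)
      = P t (comm (strongDeriv P t) (P t) y) + strongDeriv P t y := by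
  have h1 : ∀ y, P t (P t y) = P t y := fun y => DFunLike.congr_fun (hid t ht) y
  have h2 := strongDeriv_comp_add_comp_strongDeriv hP hid ht y
  have h3 := apply_strongDeriv_apply_eq_zero hP hid ht y
  simp only [comm, sub_apply, ContinuousLinearMap.comp_apply, map_sub, h1, h3]
  rw [← h2]
  simp only [map_add, h1, h3]
  abel

theorem tendsto_iSup_enorm {T : ℝ → ℝ → X →L[ℂ] X}
    (h : ∀ η : ℝ, 0 < η → ∃ ε₀ > 0, ∀ ε ∈ Ioo 0 ε₀, ∀ t ∈ I, ‖T ε t‖ ≤ η) :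
    Tendsto (fun ε : ℝ => ⨆ t ∈ I, ‖T ε t‖ₑ) (𝓝[>] 0) (𝓝 0) := by
  rw [ENNReal.tendsto_nhds_zero]
  intro η hη
  obtain ⟨η', hη', hη''⟩ := ENNReal.lt_iff_exists_nnreal_btwn.1 hη
  obtain ⟨ε₀, hε₀, h'⟩ := h η' (by exact_mod_cast hη')
  filter_upwards [Ioo_mem_nhdsGT hε₀] with ε hε
  refine iSup₂_le fun t ht => le_trans ?_ hη''.le
  rw [← ofReal_norm, ← ENNReal.ofReal_coe_nnreal]
  exact ENNReal.ofReal_le_ofReal (h' ε hε t ht)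

theorem IsEvolutionSystem.isTrajectory {A : ℝ → X →ₗ.[ℂ] X} {K : ℝ → X →L[ℂ] X} {ε : ℝ}
    {V : ℝ → ℝ → X →L[ℂ] X} (hV : IsEvolutionSystem (fun t => scaledAdd ε (A t) (K t)) V) {x : X}
    (hx : x ∈ (A 0).domain) : IsTrajectory A K ε fun t => V t 0 x := by
  intro t ht
  obtain ⟨hd, hd'⟩ := hV.solves 0 ⟨le_rfl, zero_lt_one⟩ x hx t ht
  refine ⟨hd, hd'.congr_deriv ?_⟩
  exact add_comm _ _

namespace SpectralData

variable {A : ℝ → X →ₗ.[ℂ] X} {l e : ℝ → ℂ} {P S : ℝ → X →L[ℂ] X} {R : ℝ → ℝ → X →L[ℂ] X}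
  {m : ℕ} {δ₀ M₀ : ℝ}

theorem strongContOn_comm [CompleteSpace X] (h : SpectralData A l e P S R m δ₀ M₀) :
    StrongContOn fun t => comm (strongDeriv P t) (P t) :=
  h.contDiff_proj.strongContOn_strongDeriv.comm h.contDiff_proj.strongContOn

theorem idem_comp (h : SpectralData A l e P S R m δ₀ M₀) {t : ℝ} (ht : t ∈ I) :
    P t ∘L P t = P t :=
  ContinuousLinearMap.ext (h.idem ht)

theorem scaledAdd_opComp_apply (h : SpectralData A l e P S R m δ₀ M₀) (ε : ℝ) {t : ℝ}
    (ht : t ∈ I) (K : X →L[ℂ] X) (y : X) :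
    ∃ hd : y ∈ (scaledAdd ε (opComp (A t) (P t)) K).domain,
      scaledAdd ε (opComp (A t) (P t)) K ⟨y, hd⟩
        = (K + (1 / (ε : ℂ)) • (l t • P t - S t)) y := by
  obtain ⟨hd, he⟩ := (h.nilpotent t ht).apply_proj y
  exact ⟨hd, congrArg (fun z => K y + (1 / (ε : ℂ)) • z) he⟩

theorem exists_isEvolutionSystem_opComp [CompleteSpace X] (h : SpectralData A l e P S R m δ₀ M₀)
    (hl : ContinuousOn l I) (ε : ℝ) :
    ∃ V : ℝ → ℝ → X →L[ℂ] X, IsEvolutionSystem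
      (fun t => scaledAdd ε (opComp (A t) (P t)) (comm (strongDeriv P t) (P t))) V := by
  refine exists_isEvolutionSystem (L := fun t => comm (strongDeriv P t) (P t)
    + (1 / (ε : ℂ)) • (l t • P t - S t)) ?_ fun t ht y => h.scaledAdd_opComp_apply ε ht _ y
  exact h.strongContOn_comm.add (.smul continuousOn_const
    ((StrongContOn.smul hl h.contDiff_proj.strongContOn).sub h.contDiff_nil.strongContOn))

/-- The trajectories of the evolution for `(1/ε) A P + [P', P]` that start in `P 0 X`. -/
theorem isTrajectory_opComp [CompleteSpace X] (h : SpectralData A l e P S R m δ₀ M₀) {ε : ℝ}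
    {V : ℝ → ℝ → X →L[ℂ] X} (hV : IsEvolutionSystem
      (fun t => scaledAdd ε (opComp (A t) (P t)) (comm (strongDeriv P t) (P t))) V) (x : X) :
    V 0 0 (P 0 x) = P 0 x ∧ (∀ t ∈ I, P t (V t 0 (P 0 x)) = V t 0 (P 0 x)) ∧
      IsTrajectory A (fun t => comm (strongDeriv P t) (P t)) ε fun t => V t 0 (P 0 x) := by
  have h0 : (0 : ℝ) ∈ I := ⟨le_rfl, zero_le_one⟩
  have hdom : ∀ t ∈ I, ∀ y, y ∈ (scaledAdd ε (opComp (A t) (P t))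
      (comm (strongDeriv P t) (P t))).domain := fun t ht y =>
    (h.scaledAdd_opComp_apply ε ht _ y).choose
  have hdense : ∀ t ∈ I, Dense ((scaledAdd ε (opComp (A t) (P t))
      (comm (strongDeriv P t) (P t))).domain : Set X) := fun t ht y =>
    subset_closure (hdom t ht y)
  have hPV : ∀ t ∈ I, P t (V t 0 (P 0 x)) = V t 0 (P 0 x) := fun t ht => by
    rw [hV.intertwines hdense h.contDiff_proj (fun t ht y => ?_) ht, h.idem ht]
    obtain ⟨hd1, he1⟩ := h.scaledAdd_opComp_apply ε ht (comm (strongDeriv P t) (P t)) (P t y)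
    obtain ⟨hd2, he2⟩ := h.scaledAdd_opComp_apply ε ht (comm (strongDeriv P t) (P t)) y
    refine ⟨hd1, ?_⟩
    rw [he1, he2]
    have hn := h.nilpotent t ht
    simp only [add_apply, smul_apply, sub_apply,
      comm_strongDeriv_apply_proj h.contDiff_proj (fun t ht => h.idem_comp ht) ht, map_add,
      map_smul, map_sub, hn.idem, hn.nil_proj, hn.proj_nil]
    abel
  refine ⟨hV.apply_self hdense h0 _, hPV, fun t ht => ?_⟩
  obtain ⟨hd, hd'⟩ := hV.solves 0 ⟨le_rfl, zero_lt_one⟩ (P 0 x) (hdom 0 h0 _) t ht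
  have hmem : V t 0 (P 0 x) ∈ (A t).domain := by
    obtain ⟨hd1, -⟩ := (h.nilpotent t ht).apply_proj (V t 0 (P 0 x))
    rwa [hPV t ht] at hd1
  refine ⟨hmem, hd'.congr_deriv ?_⟩
  obtain ⟨hd1, he1⟩ := h.scaledAdd_opComp_apply ε ht (comm (strongDeriv P t) (P t))
    (V t 0 (P 0 x))
  obtain ⟨hd2, he2⟩ := (h.nilpotent t ht).apply_proj (V t 0 (P 0 x))
  have he3 : A t ⟨V t 0 (P 0 x), hmem⟩
      = l t • P t (V t 0 (P 0 x)) - S t (V t 0 (P 0 x)) := by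
    rw [← he2]
    congr 2
    exact (hPV t ht).symm
  rw [he1, he3, add_comm]
  rfl

/-- The evolution for `(1/ε) A + [P', P]` is adiabatic with respect to `P`. -/
theorem intertwines [CompleteSpace X] (h : SpectralData A l e P S R m δ₀ M₀)
    (hA : ∀ t ∈ I, Dense ((A t).domain : Set X)) (hPA : ∀ t ∈ I, CommutesWith (P t) (A t))
    {ε : ℝ} {V : ℝ → ℝ → X →L[ℂ] X} (hV : IsEvolutionSystem
      (fun t => scaledAdd ε (A t) (comm (strongDeriv P t) (P t))) V) {t : ℝ} (ht : t ∈ I) (x : X) :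
    V t 0 (P 0 x) = P t (V t 0 x) := by
  refine hV.intertwines hA h.contDiff_proj (fun t ht y => ?_) ht x
  obtain ⟨hd, he⟩ := hPA t ht y
  refine ⟨hd, ?_⟩
  have h1 : scaledAdd ε (A t) (comm (strongDeriv P t) (P t)) ⟨P t y, hd⟩
    = comm (strongDeriv P t) (P t) (P t y) + (1 / (ε : ℂ)) • A t ⟨P t y, hd⟩ := rfl
  have h2 : scaledAdd ε (A t) (comm (strongDeriv P t) (P t)) y
    = comm (strongDeriv P t) (P t) y + (1 / (ε : ℂ)) • A t y := rfl
  rw [h1, h2, he, comm_strongDeriv_apply_proj h.contDiff_proj (fun t ht => h.idem_comp ht) ht,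
    map_add, map_smul]
  abel

section Limit

variable [CompleteSpace X] {U : ℝ → ℝ → ℝ → X →L[ℂ] X} {M : ℝ}

/-- Trajectories of `(1/ε) A + [P', P]` in the ranges of the projections follow the evolution of
`(1/ε) A`. -/
theorem exists_norm_sub_le_range (h : SpectralData A l e P S R m δ₀ M₀)
    (hA : ∀ t ∈ I, Dense ((A t).domain : Set X))
    (hU : ∀ ε : ℝ, 0 < ε → IsEvolutionSystem (fun t => (1 / (ε : ℂ)) • A t) (U ε)) (hM : 0 < M)
    (hUM : ∀ ε : ℝ, 0 < ε → ∀ s t : ℝ, (s, t) ∈ Triangle → ‖U ε t s‖ ≤ M) {η : ℝ} (hη : 0 < η) :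
    ∃ ε₀ > 0, ∀ ε ∈ Ioo 0 ε₀, ∀ v,
      IsTrajectory A (fun t => comm (strongDeriv P t) (P t)) ε v → (∀ t ∈ I, P t (v t) = v t) →
      ∀ t ∈ I, ‖v t - U ε t 0 (v 0)‖ ≤ η * ‖v 0‖ := by
  refine exists_norm_sub_le hA hU hM hUM h.strongContOn_comm (fun t ht y hy => ?_)
    (fun η hη => h.exists_solvesCommutator hη) hη
  have hy' : P t y = y := hy
  simp [comm, hy']

/-- Trajectories of `(1/ε) A + [P', P]` in the kernels of the projections follow the evolution of
`(1/ε) A`. -/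
theorem exists_norm_sub_le_ker (hX : Reflexive X) (h : SpectralData A l e P S R m δ₀ M₀)
    (hPn : ContDiffOn ℝ 1 P I) (hA : ∀ t ∈ I, Dense ((A t).domain : Set X))
    (hU : ∀ ε : ℝ, 0 < ε → IsEvolutionSystem (fun t => (1 / (ε : ℂ)) • A t) (U ε)) (hM : 0 < M)
    (hUM : ∀ ε : ℝ, 0 < ε → ∀ s t : ℝ, (s, t) ∈ Triangle → ‖U ε t s‖ ≤ M) {η : ℝ} (hη : 0 < η) :
    ∃ ε₀ > 0, ∀ ε ∈ Ioo 0 ε₀, ∀ v,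
      IsTrajectory A (fun t => comm (strongDeriv P t) (P t)) ε v → (∀ t ∈ I, P t (v t) = 0) →
      ∀ t ∈ I, ‖v t - U ε t 0 (v 0)‖ ≤ η * ‖v 0‖ := by
  refine exists_norm_sub_le hA hU hM hUM h.strongContOn_comm (fun t ht y hy => ?_)
    (fun η hη => h.exists_solvesCommutator' hX hPn hη) hη
  have hy' : P t y = 0 := hy
  simp [comm, hy']

/-- The evolution for `(1/ε) A P + [P', P]` approximates the evolution for `(1/ε) A` on
`P 0 X`. -/
theorem tendsto_range (h : SpectralData A l e P S R m δ₀ M₀)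
    (hA : ∀ t ∈ I, Dense ((A t).domain : Set X))
    (hU : ∀ ε : ℝ, 0 < ε → IsEvolutionSystem (fun t => (1 / (ε : ℂ)) • A t) (U ε)) (hM : 0 < M)
    (hUM : ∀ ε : ℝ, 0 < ε → ∀ s t : ℝ, (s, t) ∈ Triangle → ‖U ε t s‖ ≤ M)
    {V : ℝ → ℝ → ℝ → X →L[ℂ] X} (hV : ∀ ε : ℝ, 0 < ε → IsEvolutionSystem
      (fun t => scaledAdd ε (opComp (A t) (P t)) (comm (strongDeriv P t) (P t))) (V ε)) :
    Tendsto (fun ε : ℝ => ⨆ t ∈ I, ‖(U ε t 0 - V ε t 0) ∘L P 0‖ₑ) (𝓝[>] 0) (𝓝 0) := by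
  refine tendsto_iSup_enorm fun η hη => ?_
  have hp : 0 < ‖P 0‖ + 1 := by positivity
  obtain ⟨ε₀, hε₀, hb⟩ := h.exists_norm_sub_le_range hA hU hM hUM (div_pos hη hp)
  refine ⟨ε₀, hε₀, fun ε hε t ht => ContinuousLinearMap.opNorm_le_bound _ hη.le fun x => ?_⟩
  obtain ⟨h1, h2, h3⟩ := h.isTrajectory_opComp (hV ε hε.1) x
  have h4 := hb ε hε _ h3 h2 t ht
  simp only [h1] at h4
  rw [ContinuousLinearMap.comp_apply, sub_apply, ← norm_neg, neg_sub]
  refine h4.trans ?_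
  calc η / (‖P 0‖ + 1) * ‖P 0 x‖ ≤ η / (‖P 0‖ + 1) * ((‖P 0‖ + 1) * ‖x‖) := by
        gcongr
        exact (P 0).le_of_opNorm_le (by linarith) x
    _ = η * ‖x‖ := by field_simp

/-- In reflexive spaces, the evolution for `(1/ε) A + [P', P]` approximates the evolution for
`(1/ε) A`. The two parts of a trajectory, in the ranges and in the kernels of the projections, are
compared separately. -/
theorem tendsto_full (hX : Reflexive X) (h : SpectralData A l e P S R m δ₀ M₀)
    (hPn : ContDiffOn ℝ 1 P I) (hPA : ∀ t ∈ I, CommutesWith (P t) (A t))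
    (hA : ∀ t ∈ I, Dense ((A t).domain : Set X))
    (hU : ∀ ε : ℝ, 0 < ε → IsEvolutionSystem (fun t => (1 / (ε : ℂ)) • A t) (U ε)) (hM : 0 < M)
    (hUM : ∀ ε : ℝ, 0 < ε → ∀ s t : ℝ, (s, t) ∈ Triangle → ‖U ε t s‖ ≤ M)
    {V : ℝ → ℝ → ℝ → X →L[ℂ] X} (hV : ∀ ε : ℝ, 0 < ε → IsEvolutionSystem
      (fun t => scaledAdd ε (A t) (comm (strongDeriv P t) (P t))) (V ε)) :
    Tendsto (fun ε : ℝ => ⨆ t ∈ I, ‖U ε t 0 - V ε t 0‖ₑ) (𝓝[>] 0) (𝓝 0) := by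
  have h0 : (0 : ℝ) ∈ I := ⟨le_rfl, zero_le_one⟩
  refine tendsto_iSup_enorm fun η hη => ?_
  have hp : 0 < ‖P 0‖ + ‖1 - P 0‖ + 1 := by positivity
  have hη' := div_pos hη hp
  obtain ⟨ε₁, hε₁, hb₁⟩ := h.exists_norm_sub_le_range hA hU hM hUM hη'
  obtain ⟨ε₂, hε₂, hb₂⟩ := h.exists_norm_sub_le_ker hX hPn hA hU hM hUM hη'
  refine ⟨min ε₁ ε₂, lt_min hε₁ hε₂, fun ε hε t ht =>
    ContinuousLinearMap.opNorm_le_bound _ hη.le fun x => ?_⟩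
  have hVε := hV ε hε.1
  have hself : ∀ y, V ε 0 0 y = y := fun y => hVε.apply_self hA h0 y
  have hPV : ∀ t ∈ I, ∀ y, V ε t 0 (P 0 y) = P t (V ε t 0 y) := fun t ht y =>
    h.intertwines hA hPA hVε ht y
  suffices ∀ x ∈ (A 0).domain, ‖(U ε t 0 - V ε t 0) x‖ ≤ η * ‖x‖ from
    (isClosed_le ((U ε t 0 - V ε t 0).continuous.norm)
      (continuous_const.mul continuous_norm)).closure_subset_iff.2 this (hA 0 h0 x)
  intro x hx
  have hPx : P 0 x ∈ (A 0).domain := (hPA 0 h0 ⟨x, hx⟩).choose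
  have h1 := hb₁ ε ⟨hε.1, hε.2.trans_le (min_le_left _ _)⟩ _ (hVε.isTrajectory hPx)
    (fun t ht => by rw [hPV t ht, h.idem ht]) t ht
  have h2 := hb₂ ε ⟨hε.1, hε.2.trans_le (min_le_right _ _)⟩ _
    (hVε.isTrajectory ((A 0).domain.sub_mem hx hPx))
    (fun t ht => by rw [map_sub, hPV t ht, map_sub, h.idem ht, sub_self]) t ht
  simp only [hself] at h1 h2
  have h3 : (U ε t 0 - V ε t 0) x = -((V ε t 0 (P 0 x) - U ε t 0 (P 0 x))
      + (V ε t 0 (x - P 0 x) - U ε t 0 (x - P 0 x))) := by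
    simp only [sub_apply, map_sub]
    abel
  have h4 : ‖x - P 0 x‖ ≤ ‖1 - P 0‖ * ‖x‖ := (1 - P 0).le_opNorm x
  rw [h3, norm_neg]
  refine (norm_add_le _ _).trans ((add_le_add h1 h2).trans ?_)
  calc _ = η / (‖P 0‖ + ‖1 - P 0‖ + 1) * (‖P 0 x‖ + ‖x - P 0 x‖) := by ring
    _ ≤ η / (‖P 0‖ + ‖1 - P 0‖ + 1) * ((‖P 0‖ + ‖1 - P 0‖ + 1) * ‖x‖) := by
        gcongr
        linarith [(P 0).le_opNorm x, norm_nonneg x]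
    _ = η * ‖x‖ := by field_simp

end Limit

end SpectralData

end Adiabatic

theorem theorem3p4 {X : Type*} [NormedAddCommGroup X] [NormedSpace ℂ X] [CompleteSpace X]
    -- densely defined closed operators with evolutions `U ε` that are bounded uniformly in `ε`
    (A : ℝ → X →ₗ.[ℂ] X)
    (hAdense : ∀ t ∈ Adiabatic.I, Dense ((A t).domain : Set X))
    (hAclosed : ∀ t ∈ Adiabatic.I, (A t).IsClosed)
    (U : ℝ → ℝ → ℝ → X →L[ℂ] X)
    (hU : ∀ ε : ℝ, 0 < ε → Adiabatic.IsEvolutionSystem (fun t => (1 / (ε : ℂ)) • A t) (U ε))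
    (M : ℝ) (hM : 1 ≤ M)
    (hUM : ∀ ε : ℝ, 0 < ε → ∀ s t : ℝ, (s, t) ∈ Adiabatic.Triangle → ‖U ε t s‖ ≤ M)
    -- eigenvalues and rays in the resolvent sets
    (l : ℝ → ℂ) (hl : ∀ t ∈ Adiabatic.I, Adiabatic.IsEigenvalue (A t) (l t))
    (δ₀ : ℝ) (hδ₀ : 0 < δ₀) (θ : ℝ → ℝ)
    (hρ : ∀ δ ∈ Set.Ioc 0 δ₀, ∀ t ∈ Adiabatic.I,
      l t + δ * Complex.exp (Complex.I * θ t) ∈ Adiabatic.resolventSetOf (A t))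
    (hlC1 : ContDiffOn ℝ 1 l Adiabatic.I)
    (hθC1 : ContDiffOn ℝ 1 (fun t => Complex.exp (Complex.I * θ t)) Adiabatic.I)
    (hRC1 : ∀ δ ∈ Set.Ioc 0 δ₀, Adiabatic.StrongC1
      (fun t => Adiabatic.resolventOp (A t) (l t + δ * Complex.exp (Complex.I * θ t))))
    -- projections
    (P : ℝ → X →L[ℂ] X) (hPidem : ∀ t ∈ Adiabatic.I, P t ∘L P t = P t)
    (hPassoc : ∀ᵐ t ∂(MeasureTheory.volume.restrict Adiabatic.I),
      Adiabatic.WeaklyAssociated (A t) (l t) (P t))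
    (m₀ : ℕ) (hm₀ : 1 ≤ m₀)
    (hPcomm : ∀ t ∈ Adiabatic.I, Adiabatic.CommutesWith (P t) (A t))
    (hPker : ∀ t ∈ Adiabatic.I, ∀ x : X, P t x ∈ Adiabatic.kerPow (A t) (l t) m₀)
    (hPrank : FiniteDimensional ℂ (LinearMap.range (P 0 : X →ₗ[ℂ] X)))
    (hPC1 : Adiabatic.StrongC1 P)
    -- resolvent estimates
    (M₀ M₀' : ℝ) (hM₀ : 0 < M₀) (hM₀' : 0 < M₀')
    (hR : ∀ δ ∈ Set.Ioc 0 δ₀, ∀ t ∈ Adiabatic.I,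
      ‖Adiabatic.resolventOp (A t) (l t + δ * Complex.exp (Complex.I * θ t)) ∘L (1 - P t)‖
        ≤ M₀ / δ)
    (hR' : ∀ δ ∈ Set.Ioc 0 δ₀, ∀ t ∈ Adiabatic.I,
      ‖Adiabatic.strongDeriv (fun s =>
          Adiabatic.resolventOp (A s) (l s + δ * Complex.exp (Complex.I * θ s)) ∘L (1 - P s)) t‖
        ≤ M₀' / δ ^ (m₀ + 1)) :
    -- (i) the evolution for `(1/ε) A P + [P', P]` exists on `X` and approximates `U ε` on `P 0 X`
    ((∀ t ∈ Adiabatic.I, (Adiabatic.opComp (A t) (P t)).domain = ⊤) ∧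
      (∀ ε : ℝ, 0 < ε → ∃ V : ℝ → ℝ → X →L[ℂ] X, Adiabatic.IsEvolutionSystem
        (fun t => Adiabatic.scaledAdd ε (Adiabatic.opComp (A t) (P t))
          (Adiabatic.comm (Adiabatic.strongDeriv P t) (P t))) V) ∧
      ∀ V₀ : ℝ → ℝ → ℝ → X →L[ℂ] X,
        (∀ ε : ℝ, 0 < ε → Adiabatic.IsEvolutionSystem
          (fun t => Adiabatic.scaledAdd ε (Adiabatic.opComp (A t) (P t))
            (Adiabatic.comm (Adiabatic.strongDeriv P t) (P t))) (V₀ ε)) →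
        Filter.Tendsto (fun ε : ℝ => ⨆ t ∈ Adiabatic.I, ‖(U ε t 0 - V₀ ε t 0) ∘L P 0‖ₑ)
          (𝓝[>] 0) (𝓝 0)) ∧
    -- (ii) the reflexive case
    (Adiabatic.Reflexive X → ContDiffOn ℝ 1 P Adiabatic.I →
      ∀ V : ℝ → ℝ → ℝ → X →L[ℂ] X,
        (∀ ε : ℝ, 0 < ε → Adiabatic.IsEvolutionSystem
          (fun t => Adiabatic.scaledAdd ε (A t)
            (Adiabatic.comm (Adiabatic.strongDeriv P t) (P t))) (V ε)) →
        Filter.Tendsto (fun ε : ℝ => ⨆ t ∈ Adiabatic.I, ‖U ε t 0 - V ε t 0‖ₑ)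
          (𝓝[>] 0) (𝓝 0)) := by
  obtain ⟨S, h⟩ := Adiabatic.exists_spectralData hδ₀ hρ hθC1 hRC1 hPidem hPassoc hm₀ hPcomm hPker
    hPrank hPC1 hR
  have hM0 : 0 < M := zero_lt_one.trans_le hM
  refine ⟨⟨fun t ht => ?_, fun ε _ => h.exists_isEvolutionSystem_opComp hlC1.continuousOn ε,
    fun V₀ hV₀ => h.tendsto_range hAdense hU hM0 hUM hV₀⟩,
    fun hX hPn V hV => h.tendsto_full hX hPn hPcomm hAdense hU hM0 hUM hV⟩
  exact eq_top_iff.2 fun y _ => ((h.nilpotent t ht).apply_proj y).choose
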